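/- **Setting.** Let $(\mathbb M,\tau,\oplus)$ be an abelian topological monoid with neutral element $\boldsymbol e$ whose topology is locally compact, second countable and Hausdorff. A character is a map $\chi:\mathbb M\to[0,1]$ with $\chi(\boldsymbol e)=1$ and $\chi(x\oplus y)=\chi(x)\chi(y)$. Let $\widetilde{\mathbb M}$ be a non-empty countable set of Borel measurable characters, closed under pointwise multiplication, such that for every sequence $(x_n)$ in $\mathbb M$: (i) $\chi(x_n)\to0$ for all $\chi\in\widetilde{\mathbb M}$ if and only if $(x_n)$ eventually leaves every compact set; (ii) if $\chi(x_n)\to\psi(\chi)$ for all $\chi\in\widetilde{\mathbb M}$ and $\psi\not\equiv0$, then there is $x\in\mathbb M$ with $x_n\to x$ and $\psi(\chi)=\chi(x)$ for all $\chi\in\widetilde{\mathbb M}$. (Then $(\mathbb M,\widetilde{\mathbb M})$ is called a Feller topological monoid.) Let $(\mu_t)_{t\ge0}$ be a family of Borel probability measures on $\mathbb M$, and write $\mathscr L_{\mu}(\chi)=\int_{\mathbb M}\chi\,d\mu$. **Theorem (Lévy–Khintchine representation).** The following conditions are equivalent. (a) With $P_t(x,A)=\int_{\mathbb M}1_A(x\oplus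 y)\,\mu_t(dy)$, the operators $P_tf(x)=\int_{\mathbb M} f(y)\,P_t(x,dy)$ form a Feller semigroup on $C_0(\mathbb M)$: they are bounded linear operators of $C_0(\mathbb M)$ into itself with $P_0=\mathrm{Id}$, $\|P_t\|\le1$, $P_{s+t}=P_sP_t$, and $\lim_{t\downarrow0}\|P_tf-f\|=0$ for every $f\in C_0(\mathbb M)$. (b) $(\mu_t)_{t\ge0}$ is an $\oplus$-convolution semigroup: $\mu_0=\delta_{\boldsymbol e}$; for all $s,t\ge0$, $\mu_{s+t}$ is the image of $\mu_s\otimes\mu_t$ under $(x,y)\mapsto x\oplus y$; and $\mu_t\to\delta_{\boldsymbol e}$ vaguely as $t\downarrow0$. Moreover, let $(\chi_n)_{n\ge1}$ be an ordering (finite or infinite, without repetition) of $\widetilde{\mathbb M}$, put $\varphi=\sum_{n}2^{-n}(1-\chi_n)$, and suppose that condition (I) holds for this ordering: for every $\chi\in\widetilde{\mathbb M}$ the limit $$\alpha(\chi)=\lim_{x\to\boldsymbol e,\ x\ne\boldsymbol e}\frac{1-\chi(x)}{\varphi(x)}$$ exists in $[0,\infty)$. (If $\boldsymbol e$ is isolated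 the limit is void, and $\alpha$ may be any $[0,\infty)$-valued function on $\widetilde{\mathbb M}$.) If (a) or (b) holds, then there are a function $a:\widetilde{\mathbb M}\to[0,\infty)$ with $a(\chi_1\chi_2)=a(\chi_1)+a(\chi_2)$ for all $\chi_1,\chi_2\in\widetilde{\mathbb M}$ and a Borel measure $\Pi$ on $\mathbb M\setminus\{\boldsymbol e\}$ with $\int_{\mathbb M\setminus\{\boldsymbol e\}}(1-\chi)\,d\Pi<\infty$ for all $\chi\in\widetilde{\mathbb M}$, such that $$\mathscr L_{\mu_t}(\chi)=\exp\Big\{-t\Big(a(\chi)+\int_{\mathbb M\setminus\{\boldsymbol e\}}\big(1-\chi(x)\big)\,\Pi(dx)\Big)\Big\},\qquad \chi\in\widetilde{\mathbb M},\ t\ge0,$$ and such that $a=c\,\alpha$ for some constant $c\ge0$ whenever at least one of the following holds: $\alpha\not\equiv0$; or $x\oplus x=x$ for all $x\in\mathbb M$; or $\sum_n2^{-n}\big(-\log\mathscr L_{\mu_1}(\chi_n)\big)<\infty$. -/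

import Mathlib

open MeasureTheory Filter Topology Set
open scoped NNReal ZeroAtInfty

noncomputable section

namespace FellerMonoid

/-- A character of the commutative monoid `(M, +, 0)`: a monoid homomorphism from `(M, +)` to
`([0, 1], ·)`, seen as a real-valued function. -/
structure IsCharacter {M : Type*} [AddCommMonoid M] (χ : M → ℝ) : Prop where
  mem_Icc : ∀ x, χ x ∈ Icc (0 : ℝ) 1
  map_zero : χ 0 = 1
  map_add : ∀ x y, χ (x + y) = χ x * χ y

/-- The Borel measurable characters of `M`. -/
def Ch (M : Type*) [AddCommMonoid M] [MeasurableSpace M] : Set (M → ℝ) :=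
  {χ | IsCharacter χ ∧ Measurable χ}

/-- `(M, 𝒳)` is a Feller topological monoid, i.e. `M` is an abelian topological monoid whose
topology is locally compact, second countable and Hausdorff, and `𝒳` is a determining class of
characters on `M`. A sequence tends to the point at infinity of `M` when it eventually leaves every
compact set, that is, when it tends to `cocompact M`. -/
structure IsFellerTopologicalMonoid (M : Type*) [AddCommMonoid M] [TopologicalSpace M]
    [MeasurableSpace M] [BorelSpace M] (𝒳 : Set (M → ℝ)) : Prop where
  continuousAdd : ContinuousAdd M
  locallyCompact : LocallyCompactSpace M
  secondCountable : SecondCountableTopology M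
  t2 : T2Space M
  subset_Ch : 𝒳 ⊆ Ch M
  nonempty : 𝒳.Nonempty
  countable : 𝒳.Countable
  mul_mem : ∀ χ₁ ∈ 𝒳, ∀ χ₂ ∈ 𝒳, χ₁ * χ₂ ∈ 𝒳
  tendsto_infty_iff : ∀ x : ℕ → M,
    (∀ χ ∈ 𝒳, Tendsto (fun n => χ (x n)) atTop (𝓝 0)) ↔ Tendsto x atTop (cocompact M)
  exists_limit : ∀ (x : ℕ → M) (ψ : 𝒳 → ℝ),
    (∀ χ : 𝒳, Tendsto (fun n => (χ : M → ℝ) (x n)) atTop (𝓝 (ψ χ))) → (∃ χ, ψ χ ≠ 0) →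
      ∃ y : M, Tendsto x atTop (𝓝 y) ∧ ∀ χ : 𝒳, ψ χ = (χ : M → ℝ) y

/-- An ordering `(χ_n)_{n ≥ 1}`, finite or infinite and without repetition, of a countable set of
characters, given by the position `ord χ` of each `χ`; positions are counted from `0` and form an
initial segment of `ℕ`. -/
def IsOrdering {M : Type*} (𝒳 : Set (M → ℝ)) (ord : 𝒳 → ℕ) : Prop :=
  Function.Injective ord ∧ IsLowerSet (range ord)

/-- The function `φ = ∑_{n ≥ 1} (1 - χ_n) / 2 ^ n` of an ordering; since positions are counted from
`0`, the weight of `χ` is `1 / 2 ^ (ord χ + 1)`. -/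
def phi {M : Type*} (𝒳 : Set (M → ℝ)) (ord : 𝒳 → ℕ) (x : M) : ℝ :=
  ∑' χ : 𝒳, (1 - (χ : M → ℝ) x) / 2 ^ (ord χ + 1)

/-- Condition (I) for the given ordering, with limit function `α`: for every `χ` in `𝒳` the ratio
`(1 - χ x) / φ x` tends to `α χ ∈ [0, ∞)` as `x` tends to the neutral element, `x` being different
from it. -/
def ConditionI {M : Type*} [AddCommMonoid M] [TopologicalSpace M] (𝒳 : Set (M → ℝ)) (ord : 𝒳 → ℕ)
    (α : (M → ℝ) → ℝ) : Prop :=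
  ∀ χ ∈ 𝒳, 0 ≤ α χ ∧ Tendsto (fun x => (1 - χ x) / phi 𝒳 ord x) (𝓝[≠] 0) (𝓝 (α χ))

/-- The Laplace transform of a finite measure. -/
def laplace {M : Type*} [MeasurableSpace M] (μ : Measure M) (χ : M → ℝ) : ℝ :=
  ∫ x, χ x ∂μ

/-- A Feller semigroup on `C₀(E)`. -/
structure IsFellerSemigroup {E : Type*} [TopologicalSpace E]
    (T : ℝ≥0 → (C₀(E, ℝ) →L[ℝ] C₀(E, ℝ))) : Prop where
  map_zero : T 0 = ContinuousLinearMap.id ℝ C₀(E, ℝ)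
  norm_le_one : ∀ t, ‖T t‖ ≤ 1
  map_add : ∀ s t, T (s + t) = (T s).comp (T t)
  tendsto_zero : ∀ f, Tendsto (fun t => ‖T t f - f‖) (𝓝[>] 0) (𝓝 0)

/-- The transition probability `A ↦ P(x, A) = ∫ 1_A(x + y) μ(dy)`, as the image of `μ` under
`y ↦ x + y`. -/
def transition {M : Type*} [Add M] [MeasurableSpace M] (μ : Measure M) (x : M) : Measure M :=
  μ.map (fun y => x + y)

theorem transition_apply {M : Type*} [Add M] [TopologicalSpace M] [ContinuousAdd M]
    [MeasurableSpace M] [BorelSpace M] (μ : Measure M) (x : M) {A : Set M} (hA : MeasurableSet A) :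
    transition μ x A = ∫⁻ y, A.indicator 1 (x + y) ∂μ := by
  have h : Measurable (fun y : M => x + y) := (continuous_const_add x).measurable
  have e : (fun y => A.indicator (1 : M → ENNReal) (x + y))
      = ((fun y => x + y) ⁻¹' A).indicator 1 := rfl
  rw [transition, Measure.map_apply h hA, e, lintegral_indicator_one (h hA)]

/-- The operators `P_t f(x) = ∫ f(y) P_t(x, dy)` map `C₀(M)` into itself and form a Feller semigroup
on it. -/
def DeterminesFellerSemigroup {M : Type*} [AddCommMonoid M] [TopologicalSpace M]
    [MeasurableSpace M] (μ : ℝ≥0 → Measure M) : Prop :=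
  ∃ T : ℝ≥0 → (C₀(M, ℝ) →L[ℝ] C₀(M, ℝ)),
    (∀ t f x, T t f x = ∫ y, f y ∂(transition (μ t) x)) ∧ IsFellerSemigroup T

/-- A convolution semigroup of measures; `Measure.conv μ ν` is the image of the product measure
under addition, and the last field is vague convergence to the Dirac measure at the neutral
element. -/
structure IsConvolutionSemigroup {M : Type*} [AddCommMonoid M] [TopologicalSpace M]
    [MeasurableSpace M] (μ : ℝ≥0 → Measure M) : Prop where
  prob : ∀ t, IsProbabilityMeasure (μ t)
  map_zero : μ 0 = Measure.dirac 0
  conv : ∀ s t, (μ s).conv (μ t) = μ (s + t)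
  vague : ∀ f : M → ℝ, Continuous f → HasCompactSupport f →
    Tendsto (fun t => ∫ x, f x ∂(μ t)) (𝓝[>] 0) (𝓝 (∫ x, f x ∂(Measure.dirac (0 : M))))

end FellerMonoid

end

/-!
The characters in `𝒳` are continuous and vanish at infinity, and every sequence in `M` has a
subsequence that converges or escapes to infinity (`exists_subseq`). Since `χ (x + y) ≤ χ x`, points
that escape to infinity still do so after adding anything to them. Hence a function `f` vanishing at
infinity satisfies `sup_x |f (x + y) - f x| → 0` as `y → 0`, and `f ↦ ∫ f (· + y) m(dy)` preserves
`C₀(M)` by dominated convergence; this gives the equivalence of Feller semigroups and convolution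
semigroups (`determinesFellerSemigroup_iff`) without a density argument for the characters.

For a convolution semigroup `∫ χ dμ_t = exp (-t Φ(χ))`, and `n (1 - ∫ χ dμ_{1/n}) → Φ(χ)`. For a
positive weight `w` with `∑ w(χ) < ∞` and `∑ w(χ) Φ(χ) < ∞` put `φ = ∑ w(χ) (1 - χ)`. The measures
`n φ μ_{1/n}` have mass at most `∑ w(χ) Φ(χ)`. They are tight: a set `B = ⋃ {χ > ε}`, the union over
finitely many pairs `(χ, ε)`, is relatively compact and its complement is an ideal, so
`μ_1(B) ≤ μ_{1/n}(B) ^ n` and `n μ_{1/n}(Bᶜ) ≤ -log μ_1(B)`, which is small for large `B`. Let `κ`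
be a weak limit given by Prokhorov's theorem. The Lévy measure is `φ⁻¹ κ` on `M \ {0}`, and `a(χ)`
is `Φ(χ) - ∫ (1 - χ) / φ dκ`, the integral being over `M \ {0}` (`exists_levy_measure`).
* `a ≥ 0`, by testing with `(1 - χ) / (φ + ε)` and letting `ε → 0`.
* `a` is additive because `(1 - χ₁) (1 - χ₂) / φ` is continuous with value `0` at the neutral
  element, so that its integrals converge without loss of mass there.
* If `(1 - χ) / φ → l` at the neutral element, the extended quotient is a test function and
  `a(χ) = κ({0}) l`.

If `∑ 2⁻ⁿ Φ(χ_n) < ∞`, the weights `2⁻ⁿ` are admissible and `a = κ({0}) α`. If `α(χ₀) ≠ 0`, then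
`1 - χ₀` dominates `φ` near the neutral element and this sum is finite (`summable_of_tendsto_pos`).
If `x + x = x`, then `χ² = χ` and additivity forces `a = 0`.
-/

namespace FellerMonoid

/-! ### Characters and convergence in a Feller topological monoid -/

section Characters

theorem IsCharacter.nonneg {M : Type*} [AddCommMonoid M] {χ : M → ℝ} (h : IsCharacter χ) (x : M) :
    0 ≤ χ x := (h.mem_Icc x).1

theorem IsCharacter.le_one {M : Type*} [AddCommMonoid M] {χ : M → ℝ} (h : IsCharacter χ) (x : M) :
    χ x ≤ 1 := (h.mem_Icc x).2

variable {M : Type*} [AddCommMonoid M] [TopologicalSpace M] [MeasurableSpace M] [BorelSpace M]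
  {𝒳 : Set (M → ℝ)}

namespace IsFellerTopologicalMonoid

theorem isCharacter (hM : IsFellerTopologicalMonoid M 𝒳) {χ : M → ℝ} (hχ : χ ∈ 𝒳) :
    IsCharacter χ :=
  (hM.subset_Ch hχ).1

/-- Every sequence has a subsequence that escapes to infinity or converges: by compactness of
`[0, 1] ^ 𝒳` all characters converge along a subsequence, and the defining properties of a
Feller topological monoid identify the limit. -/
theorem exists_subseq (hM : IsFellerTopologicalMonoid M 𝒳) (x : ℕ → M) :
    ∃ k : ℕ → ℕ, StrictMono k ∧ (Tendsto (x ∘ k) atTop (cocompact M) ∨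
      ∃ y, Tendsto (x ∘ k) atTop (𝓝 y) ∧
        ∀ χ ∈ 𝒳, Tendsto (fun n => χ (x (k n))) atTop (𝓝 (χ y))) := by
  have : Countable 𝒳 := hM.countable.to_subtype
  have hc : IsCompact (Set.pi univ fun _ : 𝒳 => Icc (0 : ℝ) 1) :=
    isCompact_univ_pi fun _ => isCompact_Icc
  obtain ⟨ψ, -, k, hk, hψ⟩ := hc.tendsto_subseq (x := fun n (χ : 𝒳) => (χ : M → ℝ) (x n))
    fun n χ _ => (hM.isCharacter χ.2).mem_Icc _
  rw [tendsto_pi_nhds] at hψ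
  refine ⟨k, hk, ?_⟩
  by_cases h0 : ∃ χ, ψ χ ≠ 0
  · obtain ⟨y, hy, hyχ⟩ := hM.exists_limit (x ∘ k) ψ hψ h0
    refine Or.inr ⟨y, hy, fun χ hχ => ?_⟩
    have h := hψ ⟨χ, hχ⟩
    rwa [hyχ ⟨χ, hχ⟩] at h
  · push Not at h0
    exact Or.inl ((hM.tendsto_infty_iff _).1 fun χ hχ => h0 ⟨χ, hχ⟩ ▸ hψ ⟨χ, hχ⟩)

theorem not_tendsto_cocompact_of_tendsto_nhds (hM : IsFellerTopologicalMonoid M 𝒳) {x : ℕ → M}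
    {y : M} (h : Tendsto x atTop (𝓝 y)) : ¬ Tendsto x atTop (cocompact M) := fun h' => by
  have := hM.locallyCompact
  exact (disjoint_nhds_cocompact y).le_bot.not_gt
    (bot_lt_iff_ne_bot.2 ((atTop_neBot.map x).mono (le_inf h h')).ne)

theorem continuous (hM : IsFellerTopologicalMonoid M 𝒳) {χ : M → ℝ} (hχ : χ ∈ 𝒳) :
    Continuous χ := by
  have := hM.secondCountable
  have := hM.t2
  refine continuous_iff_seqContinuous.2 fun x y hxy => tendsto_of_subseq_tendsto fun ns hns => ?_
  obtain ⟨k, hk, h | ⟨z, hz, hzχ⟩⟩ := hM.exists_subseq (x ∘ ns)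
  · exact absurd h (hM.not_tendsto_cocompact_of_tendsto_nhds
      (hxy.comp (hns.comp hk.tendsto_atTop)))
  · obtain rfl := tendsto_nhds_unique hz (hxy.comp (hns.comp hk.tendsto_atTop))
    exact ⟨k, hzχ χ hχ⟩

theorem hasAntitoneBasis_cocompact (hM : IsFellerTopologicalMonoid M 𝒳) :
    ∃ K : ℕ → Set M, (∀ n, IsCompact (K n)) ∧ (cocompact M).HasAntitoneBasis fun n => (K n)ᶜ := by
  have := hM.locallyCompact
  have := hM.secondCountable
  let K : CompactExhaustion M := default
  refine ⟨K, K.isCompact, ⟨⟨fun s => ?_⟩, fun m n h => compl_subset_compl.2 (K.subset h)⟩⟩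
  rw [mem_cocompact]
  constructor
  · rintro ⟨t, ht, hts⟩
    obtain ⟨n, hn⟩ := K.exists_superset_of_isCompact ht
    exact ⟨n, trivial, (compl_subset_compl.2 hn).trans hts⟩
  · rintro ⟨n, -, hn⟩
    exact ⟨K n, K.isCompact n, hn⟩

theorem isCountablyGenerated_cocompact (hM : IsFellerTopologicalMonoid M 𝒳) :
    (cocompact M).IsCountablyGenerated :=
  let ⟨_, _, h⟩ := hM.hasAntitoneBasis_cocompact
  h.isCountablyGenerated

theorem tendsto_cocompact_zero (hM : IsFellerTopologicalMonoid M 𝒳) {χ : M → ℝ} (hχ : χ ∈ 𝒳) :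
    Tendsto χ (cocompact M) (𝓝 0) := by
  have := hM.isCountablyGenerated_cocompact
  exact tendsto_of_seq_tendsto fun x hx => (hM.tendsto_infty_iff x).2 hx χ hχ

theorem exists_ne_zero (hM : IsFellerTopologicalMonoid M 𝒳) (x : M) : ∃ χ ∈ 𝒳, χ x ≠ 0 := by
  by_contra! h
  refine hM.not_tendsto_cocompact_of_tendsto_nhds (tendsto_const_nhds (x := x) (f := atTop)) ?_
  exact (hM.tendsto_infty_iff _).1 fun χ hχ => by simp [h χ hχ]

theorem isCompact_le (hM : IsFellerTopologicalMonoid M 𝒳) {χ : M → ℝ} (hχ : χ ∈ 𝒳) {ε : ℝ}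
    (hε : 0 < ε) : IsCompact {x | ε ≤ χ x} := by
  obtain ⟨K, hK, hKs⟩ := mem_cocompact.1
    ((hM.tendsto_cocompact_zero hχ).eventually (gt_mem_nhds hε))
  refine hK.of_isClosed_subset (isClosed_le continuous_const (hM.continuous hχ)) fun x hx => ?_
  by_contra hxK
  have h1 : χ x < ε := hKs hxK
  have h2 : ε ≤ χ x := hx
  exact h1.not_ge h2

/-- Adding anything to points that escape to infinity gives points that escape to infinity,
because `χ (x + y) ≤ χ x`. -/
theorem tendsto_add_cocompact (hM : IsFellerTopologicalMonoid M 𝒳) {x : ℕ → M}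
    (hx : Tendsto x atTop (cocompact M)) (y : ℕ → M) :
    Tendsto (fun n => x n + y n) atTop (cocompact M) := by
  refine (hM.tendsto_infty_iff _).1 fun χ hχ => ?_
  have hc := hM.isCharacter hχ
  refine squeeze_zero (fun n => hc.nonneg _) (fun n => ?_) ((hM.tendsto_infty_iff x).2 hx χ hχ)
  rw [hc.map_add]
  exact mul_le_of_le_one_right (hc.nonneg _) (hc.le_one _)

/-- The characters detect convergence to the neutral element. -/
theorem tendsto_zero_of_forall_tendsto_one (hM : IsFellerTopologicalMonoid M 𝒳) {x : ℕ → M}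
    (hx : ∀ χ ∈ 𝒳, Tendsto (fun n => χ (x n)) atTop (𝓝 1)) : Tendsto x atTop (𝓝 0) := by
  have := hM.t2
  -- Interlacing `x` with the constant sequence `0` identifies the limit as `0`.
  let z : ℕ → M := fun n => if Even n then x n else 0
  have hz : ∀ χ : 𝒳, Tendsto (fun n => (χ : M → ℝ) (z n)) atTop (𝓝 1) := fun χ => by
    have h1 := hx χ χ.2
    have h2 := (hM.isCharacter χ.2).map_zero
    rw [Metric.tendsto_atTop] at h1 ⊢
    intro ε hε
    obtain ⟨N, hN⟩ := h1 ε hε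
    refine ⟨N, fun n hn => ?_⟩
    by_cases he : Even n
    · simpa [z, he] using hN n hn
    · simpa [z, he, h2] using hε
  obtain ⟨χ₀, hχ₀⟩ := hM.nonempty
  obtain ⟨y, hy, -⟩ := hM.exists_limit z (fun _ => 1) hz ⟨⟨χ₀, hχ₀⟩, one_ne_zero⟩
  obtain ⟨w, hw, hwχ⟩ := hM.exists_limit x (fun _ => 1) (fun χ => hx χ χ.2)
    ⟨⟨χ₀, hχ₀⟩, one_ne_zero⟩
  have hodd : Tendsto (fun n : ℕ => 2 * n + 1) atTop atTop :=
    tendsto_atTop_mono (fun n => by simp; omega) tendsto_id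
  have heven : Tendsto (fun n : ℕ => 2 * n) atTop atTop :=
    tendsto_atTop_mono (fun n => by simp; omega) tendsto_id
  have h0 : y = 0 := by
    refine tendsto_nhds_unique (hy.comp hodd) ?_
    simp [Function.comp_def, z]
  have h1 : y = w := by
    refine tendsto_nhds_unique (hy.comp heven) ?_
    have : z ∘ (fun n : ℕ => 2 * n) = x ∘ (fun n : ℕ => 2 * n) := by
      ext n; simp [z]
    rw [this]
    exact hw.comp heven
  rwa [← h1, h0] at hw

/-- A function vanishing at infinity is uniformly continuous with respect to translations by
small elements. -/
theorem eventually_forall_abs_add_sub_lt (hM : IsFellerTopologicalMonoid M 𝒳) (f : C₀(M, ℝ))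
    {ε : ℝ} (hε : 0 < ε) : ∀ᶠ y in 𝓝 (0 : M), ∀ x, |f (x + y) - f x| < ε := by
  have := hM.continuousAdd
  have := hM.secondCountable
  by_contra h
  rw [not_eventually] at h
  obtain ⟨y, hy, hyf⟩ := exists_seq_forall_of_frequently h
  push Not at hyf
  choose x hx using hyf
  obtain ⟨k, hk, hkx⟩ := hM.exists_subseq x
  have hyk := hy.comp hk.tendsto_atTop
  have key : Tendsto (fun n => |f (x (k n) + y (k n)) - f (x (k n))|) atTop (𝓝 0) := by
    rcases hkx with h | ⟨z, hz, -⟩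
    · have h1 := (zero_at_infty f).comp (hM.tendsto_add_cocompact h (y ∘ k))
      have h2 := (zero_at_infty f).comp h
      simpa [Function.comp_def] using (h1.sub h2).abs
    · have h1 := (f.continuous.tendsto _).comp (hz.add hyk)
      have h2 := (f.continuous.tendsto _).comp hz
      simpa [Function.comp_def] using (h1.sub h2).abs
  obtain ⟨n, hn⟩ := (key.eventually (gt_mem_nhds hε)).exists
  exact absurd hn (not_lt.2 (hx (k n)))

end IsFellerTopologicalMonoid

end Characters

/-! ### Feller semigroups and convolution semigroups -/

section Equivalence

theorem norm_le_of_forall_abs_le {E : Type*} [TopologicalSpace E] {f : C₀(E, ℝ)} {C : ℝ}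
    (hC : 0 ≤ C) (h : ∀ x, |f x| ≤ C) : ‖f‖ ≤ C :=
  (BoundedContinuousFunction.norm_le (f := f.toBCF) hC).2 h

theorem abs_le_norm {E : Type*} [TopologicalSpace E] (f : C₀(E, ℝ)) (x : E) :
    |f x| ≤ ‖f‖ := f.toBCF.norm_coe_le_norm x

variable {M : Type*} [AddCommMonoid M] [TopologicalSpace M] [MeasurableSpace M] [BorelSpace M]
  {𝒳 : Set (M → ℝ)}

theorem integral_transition [ContinuousAdd M] [SecondCountableTopology M] (m : Measure M) (x : M)
    {f : M → ℝ} (hf : Continuous f) : ∫ y, f y ∂(transition m x) = ∫ y, f (x + y) ∂m :=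
  integral_map (continuous_const_add x).measurable.aemeasurable hf.aestronglyMeasurable

theorem integrable_of_zeroAtInfty {M : Type*} [TopologicalSpace M] [MeasurableSpace M]
    [BorelSpace M] [SecondCountableTopology M] (m : Measure M) [IsFiniteMeasure m]
    (f : C₀(M, ℝ)) {g : M → M} (hg : Continuous g) : Integrable (fun y => f (g y)) m :=
  Integrable.of_bound ((map_continuous f).comp hg).aestronglyMeasurable ‖f‖
    (ae_of_all _ fun _ => f.toBCF.norm_coe_le_norm _)

namespace IsFellerTopologicalMonoid

/-- The operator `f ↦ ∫ f (· + y) m(dy)` on `C₀(M)` attached to a probability measure `m`. -/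
noncomputable def convOp (hM : IsFellerTopologicalMonoid M 𝒳) (m : Measure M)
    [IsProbabilityMeasure m] : C₀(M, ℝ) →L[ℝ] C₀(M, ℝ) :=
  haveI := hM.continuousAdd
  haveI := hM.secondCountable
  LinearMap.mkContinuous
    { toFun := fun f =>
        { toFun := fun x => ∫ y, f (x + y) ∂m
          continuous_toFun := by
            refine continuous_of_dominated (bound := fun _ => ‖f‖)
              (fun x => (integrable_of_zeroAtInfty m f (continuous_const_add x)).1)
              (fun x => ae_of_all _ fun y => abs_le_norm f _) (integrable_const _)
              (ae_of_all _ fun y => (map_continuous f).comp (continuous_add_const y))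
          zero_at_infty' := by
            have := hM.isCountablyGenerated_cocompact
            refine tendsto_of_seq_tendsto fun x hx => ?_
            rw [← integral_zero M ℝ (μ := m)]
            refine tendsto_integral_of_dominated_convergence (fun _ => ‖f‖)
              (fun n => (integrable_of_zeroAtInfty m f (continuous_const_add _)).1)
              (integrable_const _) (fun n => ae_of_all _ fun y => abs_le_norm f _)
              (ae_of_all _ fun y => ?_)
            exact (zero_at_infty f).comp (hM.tendsto_add_cocompact hx fun _ => y) }
      map_add' := fun f g => by
        ext x
        exact integral_add (integrable_of_zeroAtInfty m f (continuous_const_add x))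
          (integrable_of_zeroAtInfty m g (continuous_const_add x))
      map_smul' := fun c f => by
        ext x
        exact integral_const_mul c _ } 1
    fun f => by
      rw [one_mul]
      refine norm_le_of_forall_abs_le (norm_nonneg _) fun x => ?_
      simpa using norm_integral_le_of_norm_le_const (μ := m) (f := fun y => f (x + y))
        (ae_of_all _ fun y => abs_le_norm f (x + y))

theorem convOp_apply (hM : IsFellerTopologicalMonoid M 𝒳) (m : Measure M)
    [IsProbabilityMeasure m] (f : C₀(M, ℝ)) (x : M) :
    hM.convOp m f x = ∫ y, f (x + y) ∂m := rfl

theorem norm_convOp_le (hM : IsFellerTopologicalMonoid M 𝒳) (m : Measure M)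
    [IsProbabilityMeasure m] : ‖hM.convOp m‖ ≤ 1 :=
  LinearMap.mkContinuous_norm_le _ zero_le_one _

theorem integral_conv (hM : IsFellerTopologicalMonoid M 𝒳) (m₁ m₂ : Measure M)
    [IsProbabilityMeasure m₁] [IsProbabilityMeasure m₂] (f : C₀(M, ℝ)) (x : M) :
    ∫ z, f (x + z) ∂(m₁.conv m₂) = ∫ y, ∫ z, f (x + y + z) ∂m₂ ∂m₁ := by
  have := hM.continuousAdd
  have := hM.secondCountable
  have hf : Continuous fun z => f (x + z) := (map_continuous f).comp (continuous_const_add x)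
  rw [Measure.conv, integral_map (by fun_prop) hf.aestronglyMeasurable, integral_prod]
  · simp only [add_assoc]
  · exact Integrable.of_bound ((map_continuous f).comp (by fun_prop)).aestronglyMeasurable ‖f‖
      (ae_of_all _ fun y => abs_le_norm f _)

/-- A measure is determined by the integrals of functions vanishing at infinity. -/
theorem measure_ext (hM : IsFellerTopologicalMonoid M 𝒳) (m₁ m₂ : Measure M)
    [IsFiniteMeasure m₁] [IsFiniteMeasure m₂]
    (h : ∀ f : C₀(M, ℝ), ∫ x, f x ∂m₁ = ∫ x, f x ∂m₂) : m₁ = m₂ := by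
  have := hM.secondCountable
  have := hM.t2
  have := hM.locallyCompact
  have : TopologicalSpace.PseudoMetrizableSpace M :=
    TopologicalSpace.PseudoMetrizableSpace.of_regularSpace_secondCountableTopology M
  exact Measure.ext_of_integral_eq_on_compactlySupported fun f =>
    h ⟨f.toContinuousMap, f.hasCompactSupport.is_zero_at_infty⟩

theorem tendsto_norm_convOp_sub (hM : IsFellerTopologicalMonoid M 𝒳) {μ : ℝ≥0 → Measure M}
    [∀ t, IsProbabilityMeasure (μ t)] (h : IsConvolutionSemigroup μ) (f : C₀(M, ℝ)) :
    Tendsto (fun t => ‖hM.convOp (μ t) f - f‖) (𝓝[>] 0) (𝓝 0) := by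
  have := hM.continuousAdd
  have := hM.secondCountable
  have := hM.t2
  have := hM.locallyCompact
  rw [Metric.tendsto_nhds]
  intro ε hε
  have hU := hM.eventually_forall_abs_add_sub_lt f (half_pos hε)
  obtain ⟨U, hUs, hUo, hU0⟩ := eventually_nhds_iff.1 hU
  obtain ⟨g, hg1, hg0, hgc, hg⟩ := exists_continuous_one_zero_of_isCompact
    (isCompact_singleton (x := (0 : M))) hUo.isClosed_compl
    (disjoint_compl_right_iff_subset.2 (singleton_subset_iff.2 hU0))
  have hg01 : g 0 = 1 := hg1 rfl
  have hlim := h.vague g g.continuous hgc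
  rw [integral_dirac, hg01] at hlim
  have hlim' : Tendsto (fun t => ε / 2 + 2 * ‖f‖ * (1 - ∫ x, g x ∂(μ t))) (𝓝[>] 0)
      (𝓝 (ε / 2)) := by
    simpa using (tendsto_const_nhds (x := ε / 2)).add
      (((tendsto_const_nhds (x := (1 : ℝ))).sub hlim).const_mul (2 * ‖f‖))
  filter_upwards [hlim'.eventually (gt_mem_nhds (half_lt_self hε))] with t ht
  rw [Real.dist_0_eq_abs, abs_norm]
  have hgi : Integrable g (μ t) := g.continuous.integrable_of_hasCompactSupport hgc
  have h1 : ∫ x, g x ∂(μ t) ≤ 1 := by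
    simpa using integral_mono hgi (integrable_const (1 : ℝ)) fun y => (hg y).2
  have h2 : 0 ≤ 2 * ‖f‖ * (1 - ∫ x, g x ∂(μ t)) := mul_nonneg (by positivity) (sub_nonneg.2 h1)
  refine (norm_le_of_forall_abs_le (by linarith) fun x => ?_).trans_lt ht
  have hfi := integrable_of_zeroAtInfty (μ t) f (continuous_const_add x)
  have hgi' : Integrable (fun y => 2 * ‖f‖ * (1 - g y)) (μ t) :=
    ((integrable_const (1 : ℝ)).sub hgi).const_mul _
  have e1 : (hM.convOp (μ t) f - f) x = ∫ y, (f (x + y) - f x) ∂(μ t) := by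
    rw [integral_sub hfi (integrable_const _)]
    simp [convOp_apply]
  have e2 : ε / 2 + 2 * ‖f‖ * (1 - ∫ x, g x ∂(μ t)) =
      ∫ y, (ε / 2 + 2 * ‖f‖ * (1 - g y)) ∂(μ t) := by
    rw [integral_add (integrable_const _) hgi',
      integral_const_mul, integral_sub (integrable_const _) hgi]
    simp
  rw [e1, e2]
  refine norm_integral_le_of_norm_le (f := fun y => f (x + y) - f x) ((integrable_const (ε / 2)).add hgi')
    (ae_of_all _ fun y => ?_)
  rw [Real.norm_eq_abs]
  by_cases hy : y ∈ U
  · have h1 := hUs y hy x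
    have h2 : 0 ≤ 2 * ‖f‖ * (1 - g y) :=
      mul_nonneg (by positivity) (sub_nonneg.2 (hg y).2)
    linarith
  · have h1 : g y = 0 := hg0 hy
    have h2 := abs_sub (f (x + y)) (f x)
    have h3 := abs_le_norm f (x + y)
    have h4 := abs_le_norm f x
    rw [h1]
    linarith

theorem determinesFellerSemigroup_iff (hM : IsFellerTopologicalMonoid M 𝒳)
    (μ : ℝ≥0 → Measure M) [hμ : ∀ t, IsProbabilityMeasure (μ t)] :
    DeterminesFellerSemigroup μ ↔ IsConvolutionSemigroup μ := by
  have := hM.continuousAdd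
  have := hM.secondCountable
  have := hM.t2
  constructor
  · rintro ⟨T, hT, hTF⟩
    have hT' : ∀ t f x, T t f x = ∫ y, f (x + y) ∂(μ t) := fun t f x => by
      rw [hT, integral_transition _ _ (map_continuous f)]
    have hT0 : ∀ t f, T t f 0 = ∫ y, f y ∂(μ t) := fun t f => by simp [hT']
    refine ⟨hμ, ?_, fun s t => ?_, fun f hf hfc => ?_⟩
    · refine hM.measure_ext _ _ fun f => ?_
      rw [integral_dirac, ← hT0, hTF.map_zero]
      rfl
    · refine hM.measure_ext _ _ fun f => ?_
      rw [← hT0, hTF.map_add, ContinuousLinearMap.comp_apply, hT0]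
      simpa [hT'] using hM.integral_conv (μ s) (μ t) f 0
    · let f₀ : C₀(M, ℝ) := ⟨⟨f, hf⟩, hfc.is_zero_at_infty⟩
      rw [integral_dirac]
      refine tendsto_iff_norm_sub_tendsto_zero.2
        (squeeze_zero (fun _ => norm_nonneg _) (fun t => ?_) (hTF.tendsto_zero f₀))
      refine le_trans (le_of_eq ?_) (abs_le_norm _ 0)
      rw [ZeroAtInftyContinuousMap.sub_apply, hT0]
      rfl
  · intro h
    refine ⟨fun t => hM.convOp (μ t), fun t f x => ?_, ⟨?_, fun t => hM.norm_convOp_le _,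
      fun s t => ?_, hM.tendsto_norm_convOp_sub h⟩⟩
    · rw [convOp_apply, integral_transition _ _ (map_continuous f)]
    · ext f x
      rw [convOp_apply]
      simp [h.map_zero]
    · ext f x
      rw [convOp_apply, ← h.conv, hM.integral_conv]
      rfl

end IsFellerTopologicalMonoid

end Equivalence

/-! ### The characteristic exponent -/

/-- A multiplicative `[0, 1]`-valued function on `[0, ∞)` that tends to `1` at `0` is exponential. -/
theorem pos_and_eq_exp_of_map_add_eq_mul {g : ℝ≥0 → ℝ} (h01 : ∀ t, g t ∈ Icc (0 : ℝ) 1)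
    (h0 : g 0 = 1) (hmul : ∀ s t, g (s + t) = g s * g t)
    (hlim : Tendsto g (𝓝[>] 0) (𝓝 1)) (t : ℝ≥0) :
    0 < g t ∧ g t = Real.exp (-((t : ℝ) * -Real.log (g 1))) := by
  have hpow : ∀ (n : ℕ) t, g (n * t) = g t ^ n := fun n t => by
    induction n with
    | zero => simp [h0]
    | succ n ih => rw [Nat.cast_succ, add_mul, one_mul, hmul, ih, pow_succ]
  have hpos : ∀ t, 0 < g t := fun t => by
    obtain rfl | ht := eq_or_lt_of_le (zero_le (a := t))
    · simp [h0]
    have hseq : Tendsto (fun n : ℕ => t / ((n : ℝ≥0) + 1)) atTop (𝓝[>] 0) := by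
      refine tendsto_nhdsWithin_iff.2 ⟨?_, Eventually.of_forall fun n => ?_⟩
      · have h := (tendsto_one_div_add_atTop_nhds_zero_nat (𝕜 := ℝ≥0)).const_mul t
        simpa [div_eq_mul_inv] using h
      · exact div_pos ht (by positivity)
    obtain ⟨n, hn⟩ := ((hlim.comp hseq).eventually (lt_mem_nhds zero_lt_one)).exists
    have e : ((n + 1 : ℕ) : ℝ≥0) * (t / ((n : ℝ≥0) + 1)) = t := by
      push_cast
      field_simp
    rw [← e, hpow]
    exact pow_pos hn _
  refine ⟨hpos t, ?_⟩
  let h : ℝ≥0 → ℝ := fun t => -Real.log (g t)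
  have hnn : ∀ t, 0 ≤ h t := fun t => neg_nonneg.2 (Real.log_nonpos (h01 t).1 (h01 t).2)
  have hadd : ∀ s t, h (s + t) = h s + h t := fun s t => by
    simp only [h, hmul, Real.log_mul (hpos s).ne' (hpos t).ne']
    ring
  have hmono : Monotone h := fun s t hst => by
    rw [← add_tsub_cancel_of_le hst, hadd]
    linarith [hnn (t - s)]
  have hnsmul : ∀ (n : ℕ) t, h (n * t) = n * h t := fun n t => by
    simp only [h, hpow, Real.log_pow]
    ring
  have hn1 : ∀ n : ℕ, h n = n * h 1 := fun n => by simpa using hnsmul n 1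
  -- Comparing `n * t` with its integer part shows `n * |h t - t * h 1| ≤ h 1` for all `n`.
  have key : ∀ n : ℕ, n * |h t - t * h 1| ≤ h 1 := fun n => by
    have e1 := hmono (Nat.floor_le (zero_le (a := (n : ℝ≥0) * t)))
    have e2 := hmono (Nat.lt_floor_add_one ((n : ℝ≥0) * t)).le
    have e3 : ((⌊(n : ℝ≥0) * t⌋₊ : ℝ≥0) : ℝ) ≤ n * t := by
      exact_mod_cast Nat.floor_le (zero_le (a := (n : ℝ≥0) * t))
    have e4 : (n : ℝ) * t ≤ (⌊(n : ℝ≥0) * t⌋₊ : ℝ) + 1 := by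
      exact_mod_cast (Nat.lt_floor_add_one ((n : ℝ≥0) * t)).le
    rw [hadd, hn1, hnsmul] at e2
    rw [hn1, hnsmul] at e1
    have e5 := mul_le_mul_of_nonneg_right e3 (hnn 1)
    have e6 := mul_le_mul_of_nonneg_right e4 (hnn 1)
    simp only [NNReal.coe_natCast] at e5
    rw [← abs_of_nonneg (Nat.cast_nonneg (α := ℝ) n), ← abs_mul, abs_le]
    constructor <;> nlinarith
  have heq : h t = t * h 1 := by
    by_contra hne
    have hp : 0 < |h t - t * h 1| := abs_pos.2 (sub_ne_zero.2 hne)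
    obtain ⟨n, hn⟩ := exists_nat_gt (h 1 / |h t - t * h 1|)
    rw [div_lt_iff₀ hp] at hn
    exact absurd (key n) (not_le.2 hn)
  change g t = Real.exp (-(t * h 1))
  rw [← heq]
  simp only [h, neg_neg, Real.exp_log (hpos t)]

/-- The characteristic exponent `χ ↦ -log ∫ χ dμ₁` of a convolution semigroup. -/
noncomputable def exponent {M : Type*} [MeasurableSpace M] (μ : ℝ≥0 → Measure M) (χ : M → ℝ) : ℝ :=
  -Real.log (laplace (μ 1) χ)

section Exponent

variable {M : Type*} [AddCommMonoid M] [TopologicalSpace M] [MeasurableSpace M] [BorelSpace M]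
  {𝒳 : Set (M → ℝ)}

namespace IsFellerTopologicalMonoid

theorem integrable (hM : IsFellerTopologicalMonoid M 𝒳) {χ : M → ℝ} (hχ : χ ∈ 𝒳)
    (m : Measure M) [IsFiniteMeasure m] : Integrable χ m := by
  have hc := hM.isCharacter hχ
  refine Integrable.of_bound (hM.subset_Ch hχ).2.aestronglyMeasurable 1 (ae_of_all _ fun x => ?_)
  rw [Real.norm_eq_abs, abs_of_nonneg (hc.nonneg x)]
  exact hc.le_one x

theorem laplace_mem_Icc (hM : IsFellerTopologicalMonoid M 𝒳) {χ : M → ℝ} (hχ : χ ∈ 𝒳)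
    (m : Measure M) [IsProbabilityMeasure m] : laplace m χ ∈ Icc (0 : ℝ) 1 := by
  have hc := hM.isCharacter hχ
  refine ⟨integral_nonneg hc.nonneg, ?_⟩
  simpa [laplace] using integral_mono (hM.integrable hχ m) (integrable_const (1 : ℝ)) hc.le_one

theorem laplace_conv (hM : IsFellerTopologicalMonoid M 𝒳) {χ : M → ℝ} (hχ : χ ∈ 𝒳)
    (m₁ m₂ : Measure M) [IsProbabilityMeasure m₁] [IsProbabilityMeasure m₂] :
    laplace (m₁.conv m₂) χ = laplace m₁ χ * laplace m₂ χ := by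
  have := hM.continuousAdd
  have := hM.secondCountable
  rw [laplace, Measure.conv, integral_map (by fun_prop)
    (hM.subset_Ch hχ).2.aestronglyMeasurable]
  simp only [(hM.isCharacter hχ).map_add]
  exact integral_prod_mul χ χ

theorem integral_one_sub (hM : IsFellerTopologicalMonoid M 𝒳) {χ : M → ℝ} (hχ : χ ∈ 𝒳)
    (m : Measure M) [IsProbabilityMeasure m] : ∫ x, (1 - χ x) ∂m = 1 - laplace m χ := by
  rw [integral_sub (integrable_const _) (hM.integrable hχ m)]
  simp [laplace]

variable {μ : ℝ≥0 → Measure M} [∀ t, IsProbabilityMeasure (μ t)]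

theorem tendsto_laplace (hM : IsFellerTopologicalMonoid M 𝒳) (h : IsConvolutionSemigroup μ)
    {χ : M → ℝ} (hχ : χ ∈ 𝒳) : Tendsto (fun t => laplace (μ t) χ) (𝓝[>] 0) (𝓝 1) := by
  let f : C₀(M, ℝ) := ⟨⟨χ, hM.continuous hχ⟩, hM.tendsto_cocompact_zero hχ⟩
  refine tendsto_iff_norm_sub_tendsto_zero.2
    (squeeze_zero (fun _ => norm_nonneg _) (fun t => ?_) (hM.tendsto_norm_convOp_sub h f))
  refine le_trans (le_of_eq ?_) (abs_le_norm _ 0)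
  rw [ZeroAtInftyContinuousMap.sub_apply, convOp_apply]
  simp [f, laplace, (hM.isCharacter hχ).map_zero]

theorem laplace_pos_and_eq (hM : IsFellerTopologicalMonoid M 𝒳) (h : IsConvolutionSemigroup μ)
    {χ : M → ℝ} (hχ : χ ∈ 𝒳) (t : ℝ≥0) : 0 < laplace (μ t) χ ∧
      laplace (μ t) χ = Real.exp (-((t : ℝ) * exponent μ χ)) := by
  have := hM.t2
  refine pos_and_eq_exp_of_map_add_eq_mul (g := fun t => laplace (μ t) χ)
    (fun t => hM.laplace_mem_Icc hχ _) ?_ (fun s t => ?_) (hM.tendsto_laplace h hχ) t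
  · simp [laplace, h.map_zero, (hM.isCharacter hχ).map_zero]
  · rw [← h.conv, hM.laplace_conv hχ]

theorem exponent_nonneg (hM : IsFellerTopologicalMonoid M 𝒳) {χ : M → ℝ} (hχ : χ ∈ 𝒳) :
    0 ≤ exponent μ χ :=
  neg_nonneg.2 (Real.log_nonpos (hM.laplace_mem_Icc hχ _).1 (hM.laplace_mem_Icc hχ _).2)

theorem laplace_inv_eq (hM : IsFellerTopologicalMonoid M 𝒳) (h : IsConvolutionSemigroup μ)
    {χ : M → ℝ} (hχ : χ ∈ 𝒳) (n : ℕ) :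
    laplace (μ ((n : ℝ≥0) + 1)⁻¹) χ = Real.exp (-(1 / ((n : ℝ) + 1) * exponent μ χ)) := by
  rw [(hM.laplace_pos_and_eq h hχ _).2]
  simp

theorem mul_one_sub_laplace_le (hM : IsFellerTopologicalMonoid M 𝒳)
    (h : IsConvolutionSemigroup μ) {χ : M → ℝ} (hχ : χ ∈ 𝒳) (n : ℕ) :
    ((n : ℝ) + 1) * (1 - laplace (μ ((n : ℝ≥0) + 1)⁻¹) χ) ≤ exponent μ χ := by
  have h1 : (0 : ℝ) < (n : ℝ) + 1 := by positivity
  rw [hM.laplace_inv_eq h hχ, ← le_div_iff₀' h1]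
  have h2 := Real.one_sub_le_exp_neg (1 / ((n : ℝ) + 1) * exponent μ χ)
  rw [div_mul_eq_mul_div, one_mul] at h2 ⊢
  linarith

theorem tendsto_mul_one_sub_laplace (hM : IsFellerTopologicalMonoid M 𝒳)
    (h : IsConvolutionSemigroup μ) {χ : M → ℝ} (hχ : χ ∈ 𝒳) :
    Tendsto (fun n : ℕ => ((n : ℝ) + 1) * (1 - laplace (μ ((n : ℝ≥0) + 1)⁻¹) χ)) atTop
      (𝓝 (exponent μ χ)) := by
  have hd : HasDerivAt (fun s : ℝ => -Real.exp (-(s * exponent μ χ))) (exponent μ χ) 0 := by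
    have := (((hasDerivAt_id (0 : ℝ)).mul_const (exponent μ χ)).neg.exp).neg
    simpa [Pi.neg_def] using this
  rw [hasDerivAt_iff_tendsto_slope_zero] at hd
  have hseq : Tendsto (fun n : ℕ => 1 / ((n : ℝ) + 1)) atTop (𝓝[≠] 0) :=
    tendsto_nhdsWithin_iff.2 ⟨tendsto_one_div_add_atTop_nhds_zero_nat,
      Eventually.of_forall fun n => by simp only [mem_compl_iff, mem_singleton_iff]; positivity⟩
  refine (hd.comp hseq).congr fun n => ?_
  rw [hM.laplace_inv_eq h hχ]
  simp only [Function.comp_apply, zero_add, zero_mul, neg_zero, Real.exp_zero, one_div, inv_inv,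
    smul_eq_mul]
  ring

/-! ### Uniform tightness of the rescaled small-time laws -/

theorem conv_apply_le (hM : IsFellerTopologicalMonoid M 𝒳) (m₁ m₂ : Measure M)
    [SFinite m₁] [SFinite m₂] {B : Set M} (hB : MeasurableSet B)
    (h : ∀ x y, x + y ∈ B → x ∈ B ∧ y ∈ B) : (m₁.conv m₂) B ≤ m₁ B * m₂ B := by
  have := hM.continuousAdd
  have := hM.secondCountable
  rw [Measure.conv, Measure.map_apply (by fun_prop) hB, ← Measure.prod_prod]
  exact measure_mono fun p hp => h _ _ hp

theorem apply_mul_le_pow (hM : IsFellerTopologicalMonoid M 𝒳) (h : IsConvolutionSemigroup μ)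
    {B : Set M} (hB : MeasurableSet B) (hBi : ∀ x y, x + y ∈ B → x ∈ B ∧ y ∈ B) (n : ℕ)
    (t : ℝ≥0) : μ (n * t) B ≤ μ t B ^ n := by
  induction n with
  | zero => simpa using prob_le_one
  | succ n ih =>
    rw [Nat.cast_succ, add_mul, one_mul, ← h.conv, pow_succ]
    exact (hM.conv_apply_le _ _ hB hBi).trans (mul_le_mul_left ih _)

/-- If the complement of `B` is an ideal of `M`, the rate at which small increments leave `B` is
controlled by the law at time `1`: the sum of `n` increments lies in `B` only if all of them do. -/
theorem mul_one_sub_measureReal_le (hM : IsFellerTopologicalMonoid M 𝒳)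
    (h : IsConvolutionSemigroup μ) {B : Set M} (hB : MeasurableSet B)
    (hBi : ∀ x y, x + y ∈ B → x ∈ B ∧ y ∈ B) (hB0 : 0 < (μ 1).real B) (n : ℕ) :
    ((n : ℝ) + 1) * (1 - (μ ((n : ℝ≥0) + 1)⁻¹).real B) ≤ -Real.log ((μ 1).real B) := by
  set p := (μ ((n : ℝ≥0) + 1)⁻¹).real B
  have h1 : (μ 1).real B ≤ p ^ (n + 1) := by
    have h2 := hM.apply_mul_le_pow h hB hBi (n + 1) ((n : ℝ≥0) + 1)⁻¹
    rw [Nat.cast_succ, mul_inv_cancel₀ (by positivity)] at h2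
    have h3 := ENNReal.toReal_mono (ENNReal.pow_ne_top (measure_ne_top _ _)) h2
    rwa [ENNReal.toReal_pow] at h3
  have hp : 0 < p := by
    refine lt_of_le_of_ne measureReal_nonneg fun hp => ?_
    rw [← hp, zero_pow (Nat.succ_ne_zero n)] at h1
    linarith
  have h4 := Real.log_le_log hB0 h1
  rw [Real.log_pow] at h4
  have h5 := Real.log_le_sub_one_of_pos hp
  push_cast at h4
  nlinarith [mul_le_mul_of_nonneg_left h5 (by positivity : (0 : ℝ) ≤ (n : ℝ) + 1)]

/-- The measures `(n + 1) μ_{1 / (n + 1)}` are uniformly small outside suitable compact sets: no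
mass escapes to infinity, since `μ₁` is a probability measure on `M`. -/
theorem exists_isCompact_mul_measureReal_compl_le (hM : IsFellerTopologicalMonoid M 𝒳)
    (h : IsConvolutionSemigroup μ) {δ : ℝ} (hδ : 0 < δ) : ∃ K : Set M, IsCompact K ∧
      ∀ n : ℕ, ((n : ℝ) + 1) * (μ ((n : ℝ≥0) + 1)⁻¹).real Kᶜ ≤ δ := by
  have := hM.secondCountable
  have := hM.t2
  have := hM.locallyCompact
  have : TopologicalSpace.PseudoMetrizableSpace M :=
    TopologicalSpace.PseudoMetrizableSpace.of_regularSpace_secondCountableTopology M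
  have hlt : ENNReal.ofReal (Real.exp (-δ)) < μ 1 univ := by
    rw [measure_univ, ENNReal.ofReal_lt_one, Real.exp_lt_one_iff]
    linarith
  obtain ⟨C, -, hC, hCμ⟩ := isOpen_univ.exists_lt_isCompact hlt
  let V : 𝒳 × ℕ → Set M := fun p => {x | 1 / ((p.2 : ℝ) + 1) < (p.1 : M → ℝ) x}
  have hVo : ∀ p, IsOpen (V p) := fun p =>
    isOpen_lt continuous_const (hM.continuous p.1.2)
  obtain ⟨F, hF⟩ := hC.elim_finite_subcover V hVo fun x _ => by
    obtain ⟨χ, hχ, hx⟩ := hM.exists_ne_zero x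
    obtain ⟨n, hn⟩ := exists_nat_one_div_lt
      (lt_of_le_of_ne ((hM.isCharacter hχ).nonneg x) hx.symm)
    exact mem_iUnion.2 ⟨(⟨χ, hχ⟩, n), hn⟩
  set B : Set M := ⋃ p ∈ F, V p
  have hB : MeasurableSet B := (isOpen_biUnion fun p _ => hVo p).measurableSet
  have hBi : ∀ x y, x + y ∈ B → x ∈ B ∧ y ∈ B := fun x y hxy => by
    obtain ⟨p, hp, hpx⟩ := mem_iUnion₂.1 hxy
    have hc := hM.isCharacter p.1.2
    have hpx' : 1 / ((p.2 : ℝ) + 1) < (p.1 : M → ℝ) (x + y) := hpx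
    rw [hc.map_add] at hpx'
    exact ⟨mem_iUnion₂.2 ⟨p, hp, hpx'.trans_le (mul_le_of_le_one_right (hc.nonneg _)
      (hc.le_one _))⟩, mem_iUnion₂.2 ⟨p, hp, hpx'.trans_le (mul_le_of_le_one_left (hc.nonneg _)
      (hc.le_one _))⟩⟩
  have hBμ : Real.exp (-δ) ≤ (μ 1).real B :=
    (ENNReal.ofReal_le_iff_le_toReal (measure_ne_top _ _)).1 (hCμ.le.trans (measure_mono hF))
  refine ⟨⋃ p ∈ F, {x | 1 / ((p.2 : ℝ) + 1) ≤ (p.1 : M → ℝ) x},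
    F.isCompact_biUnion fun p _ => hM.isCompact_le p.1.2 (by positivity), fun n => ?_⟩
  have h1 : (μ ((n : ℝ≥0) + 1)⁻¹).real (⋃ p ∈ F, {x | 1 / ((p.2 : ℝ) + 1) ≤ (p.1 : M → ℝ) x})ᶜ ≤
      1 - (μ ((n : ℝ≥0) + 1)⁻¹).real B := by
    rw [← probReal_compl_eq_one_sub hB]
    exact measureReal_mono (compl_subset_compl.2 
      (iUnion₂_mono fun p _ => ofPred_subset_ofPred.2 fun x hx => le_of_lt hx))
  have h2 := hM.mul_one_sub_measureReal_le h hB hBi ((Real.exp_pos _).trans_le hBμ) n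
  have h3 := Real.log_le_log (Real.exp_pos _) hBμ
  rw [Real.log_exp] at h3
  calc _ ≤ ((n : ℝ) + 1) * (1 - (μ ((n : ℝ≥0) + 1)⁻¹).real B) := by gcongr
    _ ≤ δ := by linarith

end IsFellerTopologicalMonoid

end Exponent

section Levy

/-! ### Weighted sums of the functions `1 - χ` -/

/-- The function `x ↦ ∑ w(χ) (1 - χ(x))`, the sum over `χ ∈ 𝒳`, for a weight `w`. -/
noncomputable def defect {M : Type*} (𝒳 : Set (M → ℝ)) (w : 𝒳 → ℝ) (x : M) : ℝ :=
  ∑' χ : 𝒳, w χ * (1 - (χ : M → ℝ) x)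

theorem phi_eq_defect {M : Type*} (𝒳 : Set (M → ℝ)) (ord : 𝒳 → ℕ) :
    phi 𝒳 ord = defect 𝒳 fun χ => 1 / 2 ^ (ord χ + 1) := by
  funext x
  exact tsum_congr fun χ => by ring

variable {M : Type*} [AddCommMonoid M] [TopologicalSpace M] [MeasurableSpace M] [BorelSpace M]
  {𝒳 : Set (M → ℝ)} {w : 𝒳 → ℝ}

namespace IsFellerTopologicalMonoid

theorem defect_term_mem_Icc (hM : IsFellerTopologicalMonoid M 𝒳) (hw : ∀ χ, 0 < w χ) (x : M)
    (χ : 𝒳) : w χ * (1 - (χ : M → ℝ) x) ∈ Icc 0 (w χ) := by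
  have hc := hM.isCharacter χ.2
  exact ⟨mul_nonneg (hw χ).le (sub_nonneg.2 (hc.le_one x)),
    mul_le_of_le_one_right (hw χ).le (by linarith [hc.nonneg x])⟩

theorem summable_defect (hM : IsFellerTopologicalMonoid M 𝒳) (hw : ∀ χ, 0 < w χ)
    (hws : Summable w) (x : M) : Summable fun χ : 𝒳 => w χ * (1 - (χ : M → ℝ) x) :=
  Summable.of_nonneg_of_le (fun χ => (hM.defect_term_mem_Icc hw x χ).1)
    (fun χ => (hM.defect_term_mem_Icc hw x χ).2) hws

theorem continuous_defect (hM : IsFellerTopologicalMonoid M 𝒳) (hw : ∀ χ, 0 < w χ)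
    (hws : Summable w) : Continuous (defect 𝒳 w) := by
  refine continuous_tsum (fun χ => ?_) hws fun χ x => ?_
  · exact continuous_const.mul (continuous_const.sub (hM.continuous χ.2))
  · rw [Real.norm_eq_abs, abs_of_nonneg (hM.defect_term_mem_Icc hw x χ).1]
    exact (hM.defect_term_mem_Icc hw x χ).2

theorem defect_nonneg (hM : IsFellerTopologicalMonoid M 𝒳) (hw : ∀ χ, 0 < w χ) (x : M) :
    0 ≤ defect 𝒳 w x :=
  tsum_nonneg fun χ => (hM.defect_term_mem_Icc hw x χ).1

theorem defect_le (hM : IsFellerTopologicalMonoid M 𝒳) (hw : ∀ χ, 0 < w χ)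
    (hws : Summable w) (x : M) : defect 𝒳 w x ≤ ∑' χ, w χ :=
  (hM.summable_defect hw hws x).tsum_le_tsum (fun χ => (hM.defect_term_mem_Icc hw x χ).2) hws

theorem term_le_defect (hM : IsFellerTopologicalMonoid M 𝒳) (hw : ∀ χ, 0 < w χ)
    (hws : Summable w) (x : M) (χ : 𝒳) : w χ * (1 - (χ : M → ℝ) x) ≤ defect 𝒳 w x :=
  (hM.summable_defect hw hws x).le_tsum χ fun χ _ => (hM.defect_term_mem_Icc hw x χ).1

theorem defect_zero (hM : IsFellerTopologicalMonoid M 𝒳) : defect 𝒳 w 0 = 0 := by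
  simp only [defect, fun χ : 𝒳 => (hM.isCharacter χ.2).map_zero, sub_self, mul_zero, tsum_zero]

/-- The function `∑ w(χ) (1 - χ)` is bounded below outside each neighbourhood of the neutral
element. -/
theorem exists_pos_le_defect (hM : IsFellerTopologicalMonoid M 𝒳) (hw : ∀ χ, 0 < w χ)
    (hws : Summable w) {U : Set M} (hU : U ∈ 𝓝 (0 : M)) :
    ∃ δ : ℝ, 0 < δ ∧ ∀ x ∉ U, δ ≤ defect 𝒳 w x := by
  by_contra! h
  choose x hxU hx using fun n : ℕ => h (1 / ((n : ℝ) + 1)) (by positivity)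
  have hlim : Tendsto (fun n => defect 𝒳 w (x n)) atTop (𝓝 0) :=
    squeeze_zero (fun n => hM.defect_nonneg hw _) (fun n => (hx n).le)
      tendsto_one_div_add_atTop_nhds_zero_nat
  have hx0 : Tendsto x atTop (𝓝 0) := by
    refine hM.tendsto_zero_of_forall_tendsto_one fun χ hχ => ?_
    have h1 : Tendsto (fun n => w ⟨χ, hχ⟩ * (1 - χ (x n))) atTop (𝓝 0) :=
      squeeze_zero (fun n => (hM.defect_term_mem_Icc hw _ ⟨χ, hχ⟩).1)
        (fun n => hM.term_le_defect hw hws _ ⟨χ, hχ⟩) hlim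
    have h2 := (h1.const_mul (w ⟨χ, hχ⟩)⁻¹).const_sub 1
    simpa [inv_mul_cancel_left₀ (hw ⟨χ, hχ⟩).ne'] using h2
  obtain ⟨n, hn⟩ := (hx0.eventually hU).exists
  exact hxU n hn

theorem defect_pos (hM : IsFellerTopologicalMonoid M 𝒳) (hw : ∀ χ, 0 < w χ)
    (hws : Summable w) {x : M} (hx : x ≠ 0) : 0 < defect 𝒳 w x := by
  have := hM.t2
  obtain ⟨δ, hδ, h⟩ := hM.exists_pos_le_defect hw hws (isOpen_ne.mem_nhds hx.symm)
  exact hδ.trans_le (h x (by simp))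

theorem one_sub_div_defect_mem_Icc (hM : IsFellerTopologicalMonoid M 𝒳) (hw : ∀ χ, 0 < w χ)
    (hws : Summable w) (x : M) {χ : M → ℝ} (hχ : χ ∈ 𝒳) :
    (1 - χ x) / defect 𝒳 w x ∈ Icc 0 (1 / w ⟨χ, hχ⟩) := by
  have hc := hM.isCharacter hχ
  refine ⟨div_nonneg (sub_nonneg.2 (hc.le_one x)) (hM.defect_nonneg hw x), ?_⟩
  refine div_le_of_le_mul₀ (hM.defect_nonneg hw x) (one_div_pos.2 (hw _)).le ?_
  rw [div_mul_eq_mul_div, one_mul, le_div_iff₀' (hw _)]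
  exact hM.term_le_defect hw hws x ⟨χ, hχ⟩

theorem integrable_defect (hM : IsFellerTopologicalMonoid M 𝒳) (hw : ∀ χ, 0 < w χ)
    (hws : Summable w) (m : Measure M) [IsFiniteMeasure m] : Integrable (defect 𝒳 w) m := by
  refine Integrable.of_bound (hM.continuous_defect hw hws).measurable.aestronglyMeasurable
    (∑' χ, w χ) (ae_of_all _ fun x => ?_)
  rw [Real.norm_eq_abs, abs_of_nonneg (hM.defect_nonneg hw x)]
  exact hM.defect_le hw hws x

variable {μ : ℝ≥0 → Measure M} [∀ t, IsProbabilityMeasure (μ t)]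

theorem mul_integral_defect_le (hM : IsFellerTopologicalMonoid M 𝒳)
    (h : IsConvolutionSemigroup μ) (hw : ∀ χ, 0 < w χ) (hws : Summable w)
    (hwe : Summable fun χ : 𝒳 => w χ * exponent μ χ) (n : ℕ) :
    ((n : ℝ) + 1) * ∫ x, defect 𝒳 w x ∂(μ ((n : ℝ≥0) + 1)⁻¹) ≤
      ∑' χ : 𝒳, w χ * exponent μ χ := by
  have : Countable 𝒳 := hM.countable.to_subtype
  set m := μ ((n : ℝ≥0) + 1)⁻¹
  have hint : ∀ χ : 𝒳, ∫ x, w χ * (1 - (χ : M → ℝ) x) ∂m = w χ * (1 - laplace m χ) := fun χ => by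
    rw [integral_const_mul, hM.integral_one_sub χ.2]
  have hs1 : Summable fun χ : 𝒳 => w χ * (1 - laplace m χ) := by
    refine Summable.of_nonneg_of_le (fun χ => ?_) (fun χ => ?_) hws
    · exact mul_nonneg (hw χ).le (sub_nonneg.2 (hM.laplace_mem_Icc χ.2 m).2)
    · exact mul_le_of_le_one_right (hw χ).le (by linarith [(hM.laplace_mem_Icc χ.2 m).1])
  have hs := hasSum_integral_of_summable_integral_norm (μ := m)
    (F := fun (χ : 𝒳) x => w χ * (1 - (χ : M → ℝ) x))
    (fun χ => ((integrable_const (1 : ℝ)).sub (hM.integrable χ.2 m)).const_mul _) (by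
      refine hs1.congr fun χ => ?_
      rw [← hint]
      refine integral_congr_ae (ae_of_all _ fun x => ?_)
      exact (Real.norm_of_nonneg (hM.defect_term_mem_Icc hw x χ).1).symm)
  simp only [hint] at hs
  change _ * ∫ x, ∑' χ : 𝒳, w χ * (1 - (χ : M → ℝ) x) ∂m ≤ _
  rw [← hs.tsum_eq, ← tsum_mul_left]
  refine (hs1.mul_left _).tsum_le_tsum (fun χ => ?_) hwe
  have h1 := mul_le_mul_of_nonneg_left (hM.mul_one_sub_laplace_le h χ.2 n) (hw χ).le
  calc _ = w χ * (((n : ℝ) + 1) * (1 - laplace m χ)) := by ring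
    _ ≤ _ := h1

/-! ### The limit of the rescaled small-time laws -/

/-- The finite measures `(n + 1) (∑ w(χ) (1 - χ)) μ_{1 / (n + 1)}` have bounded mass and are tight,
hence by Prokhorov's theorem they converge weakly along some filter. -/
theorem exists_limit_measure (hM : IsFellerTopologicalMonoid M 𝒳)
    (h : IsConvolutionSemigroup μ) (hw : ∀ χ, 0 < w χ) (hws : Summable w)
    (hwe : Summable fun χ : 𝒳 => w χ * exponent μ χ) :
    ∃ (κ : Measure M) (U : Filter ℕ), IsFiniteMeasure κ ∧ U.NeBot ∧ U ≤ atTop ∧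
      ∀ (f : M → ℝ) (C : ℝ), Continuous f → (∀ x, |f x| ≤ C) →
        Tendsto (fun n : ℕ => ((n : ℝ) + 1) *
          ∫ x, f x * defect 𝒳 w x ∂(μ ((n : ℝ≥0) + 1)⁻¹)) U (𝓝 (∫ x, f x ∂κ)) := by
  have := hM.secondCountable
  have := hM.t2
  have := hM.locallyCompact
  have hd0 := hM.defect_nonneg hw
  have hdW := hM.defect_le hw hws
  have hdm := (hM.continuous_defect hw hws).measurable
  set W := ∑' χ, w χ
  have hW : 0 ≤ W := tsum_nonneg fun χ => (hw χ).le
  let ρ : ℕ → M → ℝ≥0 := fun n x => Real.toNNReal (((n : ℝ) + 1) * defect 𝒳 w x)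
  have hρ : ∀ n, Measurable (ρ n) := fun n => (hdm.const_mul _).real_toNNReal
  let m : ℕ → Measure M := fun n => (μ ((n : ℝ≥0) + 1)⁻¹).withDensity fun x => ρ n x
  have hm : ∀ n, IsFiniteMeasure (m n) := fun n =>
    isFiniteMeasure_withDensity_ofReal
      ((hM.integrable_defect hw hws (μ ((n : ℝ≥0) + 1)⁻¹)).const_mul _).2
  have hint : ∀ n (f : M → ℝ), ∫ x, f x ∂(m n) =
      ((n : ℝ) + 1) * ∫ x, f x * defect 𝒳 w x ∂(μ ((n : ℝ≥0) + 1)⁻¹) := fun n f => by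
    rw [integral_withDensity_eq_integral_smul (hρ n), ← integral_const_mul]
    refine integral_congr_ae (ae_of_all _ fun x => ?_)
    simp only [NNReal.smul_def, ρ, smul_eq_mul]
    rw [Real.coe_toNNReal _ (mul_nonneg (by positivity) (hd0 x))]
    ring
  have hcompl : ∀ n (s : Set M), MeasurableSet s →
      (m n).real s ≤ W * (((n : ℝ) + 1) * (μ ((n : ℝ≥0) + 1)⁻¹).real s) := fun n s hs => by
    rw [← integral_indicator_one hs, hint, mul_left_comm, ← integral_indicator_one hs,
      ← integral_const_mul W]
    refine mul_le_mul_of_nonneg_left (integral_mono_of_nonneg (ae_of_all _ fun x => ?_)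
      ((((integrable_const (1 : ℝ)).indicator hs).const_mul _) :
        Integrable (fun x => W * s.indicator 1 x) (μ ((n : ℝ≥0) + 1)⁻¹)) (ae_of_all _ fun x => ?_))
      (by positivity)
    · exact mul_nonneg (indicator_nonneg (fun _ _ => zero_le_one) _) (hd0 x)
    · by_cases hx : x ∈ s
      · simpa [hx] using hdW x
      · simp [hx]
  have hmass : ∀ n, (m n).real univ ≤ ∑' χ : 𝒳, w χ * exponent μ χ := fun n => by
    have h1 := hint n fun _ => 1
    simp only [integral_const, smul_eq_mul, mul_one, one_mul] at h1
    rw [h1]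
    exact hM.mul_integral_defect_le h hw hws hwe n
  choose K hK hKle using fun j : ℕ =>
    hM.exists_isCompact_mul_measureReal_compl_le h (δ := 1 / ((j : ℝ) + 1) / (W + 1))
      (by positivity)
  let κs : ℕ → FiniteMeasure M := fun n => ⟨m n, hm n⟩
  have hcomp := isCompact_setOfPred_finiteMeasure_mass_le_compl_isCompact_le
    (u := fun j : ℕ => 1 / ((j : ℝ≥0) + 1)) (K := K)
    (Real.toNNReal (∑' χ : 𝒳, w χ * exponent μ χ))
    tendsto_one_div_add_atTop_nhds_zero_nat hK (Or.inl inferInstance)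
  have hmem : ∀ n, κs n ∈ {κ : FiniteMeasure M |
      κ.mass ≤ Real.toNNReal (∑' χ : 𝒳, w χ * exponent μ χ) ∧
        ∀ j : ℕ, κ (K j)ᶜ ≤ 1 / ((j : ℝ≥0) + 1)} := fun n => by
    refine ⟨NNReal.le_toNNReal_of_coe_le (hmass n), fun j => NNReal.coe_le_coe.1 ?_⟩
    have h1 : (m n).real (K j)ᶜ ≤ 1 / ((j : ℝ) + 1) := by
      refine (hcompl n _ (hK j).measurableSet.compl).trans ?_
      refine (mul_le_mul_of_nonneg_left (hKle j n) hW).trans ?_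
      rw [mul_div_left_comm]
      refine mul_le_of_le_one_right (by positivity) ?_
      rw [div_le_one (by positivity)]
      linarith
    have h2 : ((1 / ((j : ℝ≥0) + 1) : ℝ≥0) : ℝ) = 1 / ((j : ℝ) + 1) := by simp
    rw [h2]
    exact h1
  obtain ⟨κ, -, hκ⟩ := hcomp.ultrafilter_le_nhds ((hyperfilter ℕ).map κs)
    (by
      rw [Ultrafilter.coe_map]
      exact tendsto_principal.2 (Eventually.of_forall hmem))
  have hlim : Tendsto κs (hyperfilter ℕ : Filter ℕ) (𝓝 κ) := hκ
  rw [FiniteMeasure.tendsto_iff_forall_integral_tendsto] at hlim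
  refine ⟨κ, hyperfilter ℕ, inferInstance, inferInstance, Nat.hyperfilter_le_atTop,
    fun f C hf hC => ?_⟩
  exact (hlim (BoundedContinuousFunction.ofNormedAddCommGroup f hf C hC)).congr
    fun n => hint n f

/-- The product `(1 - χ₁) (1 - χ₂)` is negligible against `∑ w(χ) (1 - χ)` at the neutral
element. -/
theorem continuous_mul_div_defect (hM : IsFellerTopologicalMonoid M 𝒳) (hw : ∀ χ, 0 < w χ)
    (hws : Summable w) {χ₁ χ₂ : M → ℝ} (h₁ : χ₁ ∈ 𝒳) (h₂ : χ₂ ∈ 𝒳) :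
    Continuous fun x => (1 - χ₁ x) * (1 - χ₂ x) / defect 𝒳 w x := by
  refine continuous_iff_continuousAt.2 fun x => ?_
  have c₁ := hM.continuous h₁
  have c₂ := hM.continuous h₂
  by_cases hx : x = 0
  · subst hx
    have e : (1 - χ₁ 0) * (1 - χ₂ 0) / defect 𝒳 w 0 = 0 := by simp [hM.defect_zero]
    have hlim : Tendsto (fun x => 1 / w ⟨χ₁, h₁⟩ * (1 - χ₂ x)) (𝓝 0) (𝓝 0) := by
      have h0 : 1 / w ⟨χ₁, h₁⟩ * (1 - χ₂ 0) = 0 := by simp [(hM.isCharacter h₂).map_zero]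
      have : Continuous fun x => 1 / w ⟨χ₁, h₁⟩ * (1 - χ₂ x) := by fun_prop
      simpa only [h0] using this.tendsto 0
    rw [ContinuousAt, e]
    refine squeeze_zero (fun x => ?_) (fun x => ?_) hlim
    all_goals
      have b₁ := hM.one_sub_div_defect_mem_Icc hw hws x h₁
      have b₂ := sub_nonneg.2 ((hM.isCharacter h₂).le_one x)
      rw [mul_div_right_comm]
    · exact mul_nonneg b₁.1 b₂
    · exact mul_le_mul_of_nonneg_right b₁.2 b₂
  · exact ((continuous_const.sub c₁).mul (continuous_const.sub c₂)).continuousAt.div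
      (hM.continuous_defect hw hws).continuousAt (hM.defect_pos hw hws hx).ne'

/-- The Lévy–Khintchine representation attached to a weight for which `∑ w(χ) (1 - χ)` has a finite
rate. The last clause identifies the drift as the mass of the limit measure at the neutral
element. -/
theorem exists_levy_measure (hM : IsFellerTopologicalMonoid M 𝒳)
    (h : IsConvolutionSemigroup μ) (hw : ∀ χ, 0 < w χ) (hws : Summable w)
    (hwe : Summable fun χ : 𝒳 => w χ * exponent μ χ) :
    ∃ (a : (M → ℝ) → ℝ) (ν : Measure {x : M // x ≠ 0}),
      (∀ χ ∈ 𝒳, 0 ≤ a χ) ∧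
      (∀ χ₁ ∈ 𝒳, ∀ χ₂ ∈ 𝒳, a (χ₁ * χ₂) = a χ₁ + a χ₂) ∧
      (∀ χ ∈ 𝒳, Integrable (fun x : {x : M // x ≠ 0} => 1 - χ x) ν) ∧
      (∀ χ ∈ 𝒳, exponent μ χ = a χ + ∫ x : {x : M // x ≠ 0}, (1 - χ x) ∂ν) ∧
      ∃ c : ℝ, 0 ≤ c ∧ ∀ χ ∈ 𝒳, ∀ l : ℝ,
        Tendsto (fun x => (1 - χ x) / defect 𝒳 w x) (𝓝[≠] 0) (𝓝 l) → a χ = c * l := by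
  classical
  have := hM.secondCountable
  have := hM.t2
  obtain ⟨κ, U, hκ, hU, hUtop, hlim⟩ := hM.exists_limit_measure h hw hws hwe
  have hdc := hM.continuous_defect hw hws
  have hd0 := hM.defect_nonneg (w := w) hw
  let ρ : M → ℝ≥0 := fun x => Real.toNNReal (defect 𝒳 w x)⁻¹
  have hρ : Measurable ρ := hdc.measurable.inv.real_toNNReal
  let e : {x : M // x ≠ 0} → M := Subtype.val
  have hrange : range e = {0}ᶜ := by ext x; simp [e]
  have he : MeasurableEmbedding e := by
    refine ⟨Subtype.val_injective, measurable_subtype_coe, fun {s} hs => ?_⟩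
    exact (MeasurableEmbedding.subtype_coe (s := {0}ᶜ)
      (measurableSet_singleton (0 : M)).compl).measurableSet_image' hs
  let κ' : Measure M := κ.withDensity fun x => ρ x
  have hρsmul : ∀ (g : M → ℝ) x, ρ x • g x = g x / defect 𝒳 w x := fun g x => by
    rw [NNReal.smul_def, smul_eq_mul, Real.coe_toNNReal _ (inv_nonneg.2 (hd0 x))]
    ring
  have hmap : (κ'.comap e).map e = κ'.restrict {0}ᶜ := by rw [he.map_comap, hrange]
  have hGi : ∀ χ ∈ 𝒳, Integrable (fun x => (1 - χ x) / defect 𝒳 w x) κ := fun χ hχ => by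
    refine Integrable.of_bound ((measurable_const.sub (hM.subset_Ch hχ).2).div
      hdc.measurable).aestronglyMeasurable (1 / w ⟨χ, hχ⟩) (ae_of_all _ fun x => ?_)
    have hb := hM.one_sub_div_defect_mem_Icc hw hws x hχ
    rw [Real.norm_of_nonneg hb.1]
    exact hb.2
  -- The integral against the Lévy measure is the integral against `κ` of the quotient by
  -- `∑ w(χ) (1 - χ)`; the latter vanishes at `0` because division by `0` gives `0`.
  have hνint : ∀ χ ∈ 𝒳, ∫ x : {x : M // x ≠ 0}, (1 - χ x) ∂(κ'.comap e) =
      ∫ x, (1 - χ x) / defect 𝒳 w x ∂κ := fun χ hχ => by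
    have h1 := he.integral_map (μ := κ'.comap e) fun x => 1 - χ x
    rw [hmap, setIntegral_eq_integral_of_forall_compl_eq_zero,
      integral_withDensity_eq_integral_smul hρ] at h1
    · rw [← h1]
      exact integral_congr_ae (ae_of_all _ fun x => hρsmul (fun x => 1 - χ x) x)
    · intro x hx
      have hx0 : x = 0 := by simpa using hx
      simp [hx0, (hM.isCharacter hχ).map_zero]
  let G : (M → ℝ) → ℝ := fun χ => ∫ x, (1 - χ x) / defect 𝒳 w x ∂κ
  have hexp : ∀ χ ∈ 𝒳, Tendsto (fun n : ℕ => ((n : ℝ) + 1) *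
      ∫ x, (1 - χ x) ∂(μ ((n : ℝ≥0) + 1)⁻¹)) U (𝓝 (exponent μ χ)) := fun χ hχ => by
    simp only [hM.integral_one_sub hχ]
    exact (hM.tendsto_mul_one_sub_laplace h hχ).mono_left hUtop
  refine ⟨fun χ => exponent μ χ - G χ, κ'.comap e, fun χ hχ => sub_nonneg.2 ?_,
    fun χ₁ h₁ χ₂ h₂ => ?_, fun χ hχ => ?_, fun χ hχ => ?_, κ.real {0}, measureReal_nonneg,
    fun χ hχ l hl => ?_⟩
  · -- Replacing the denominator by `defect + ε` makes the quotient continuous at `0`.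
    have hc := hM.isCharacter hχ
    have hn0 : ∀ x, 0 ≤ 1 - χ x := fun x => sub_nonneg.2 (hc.le_one x)
    have hbound : ∀ ε : ℝ, 0 < ε → ∀ x, |(1 - χ x) / (defect 𝒳 w x + ε)| ≤ 1 / ε :=
      fun ε hε x => by
        rw [abs_of_nonneg (div_nonneg (hn0 x) (by linarith [hd0 x]))]
        exact div_le_div₀ zero_le_one (by linarith [hc.nonneg x]) hε (by linarith [hd0 x])
    have hε : ∀ ε : ℝ, 0 < ε → ∫ x, (1 - χ x) / (defect 𝒳 w x + ε) ∂κ ≤ exponent μ χ :=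
      fun ε hε => by
        have hcont : Continuous fun x => (1 - χ x) / (defect 𝒳 w x + ε) :=
          (continuous_const.sub (hM.continuous hχ)).div (hdc.add continuous_const)
            fun x => by linarith [hd0 x]
        refine le_of_tendsto_of_tendsto' (hlim _ _ hcont (hbound ε hε)) (hexp χ hχ) fun n => ?_
        refine mul_le_mul_of_nonneg_left (integral_mono_of_nonneg (ae_of_all _ fun x => ?_)
          ((integrable_const _).sub (hM.integrable hχ _)) (ae_of_all _ fun x => ?_))
          (by positivity)
        · exact mul_nonneg (div_nonneg (hn0 x) (by linarith [hd0 x])) (hd0 x)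
        · change (1 - χ x) / (defect 𝒳 w x + ε) * defect 𝒳 w x ≤ 1 - χ x
          rw [div_mul_eq_mul_div, div_le_iff₀ (by linarith [hd0 x])]
          exact mul_le_mul_of_nonneg_left (by linarith) (hn0 x)
    have hdom : Tendsto (fun n : ℕ => ∫ x, (1 - χ x) / (defect 𝒳 w x + 1 / ((n : ℝ) + 1)) ∂κ)
        atTop (𝓝 (G χ)) := by
      refine tendsto_integral_of_dominated_convergence (fun x => 1 / w ⟨χ, hχ⟩) (fun n => ?_)
        (integrable_const _) (fun n => ae_of_all _ fun x => ?_) (ae_of_all _ fun x => ?_)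
      · exact ((measurable_const.sub (hM.subset_Ch hχ).2).div
          (hdc.measurable.add_const _)).aestronglyMeasurable
      · have hp : (0 : ℝ) < 1 / ((n : ℝ) + 1) := by positivity
        have hs : 0 < defect 𝒳 w x + 1 / ((n : ℝ) + 1) := by linarith [hd0 x]
        rw [Real.norm_of_nonneg (div_nonneg (hn0 x) hs.le), div_le_div_iff₀ hs (hw _)]
        have := hM.term_le_defect hw hws x ⟨χ, hχ⟩
        linarith
      · by_cases hx : x = 0
        · simp [hx, hc.map_zero]
        · have h1 := tendsto_one_div_add_atTop_nhds_zero_nat (𝕜 := ℝ)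
          have h2 := (h1.const_add (defect 𝒳 w x))
          rw [add_zero] at h2
          exact tendsto_const_nhds.div h2 (hM.defect_pos hw hws hx).ne'
    exact le_of_tendsto' hdom fun n => hε _ (by positivity)
  · have h₁₂ := hM.mul_mem χ₁ h₁ χ₂ h₂
    have hbd : ∀ x, |(1 - χ₁ x) * (1 - χ₂ x) / defect 𝒳 w x| ≤ 1 / w ⟨χ₁, h₁⟩ := fun x => by
      have b₁ := hM.one_sub_div_defect_mem_Icc hw hws x h₁
      have b₂ := sub_nonneg.2 ((hM.isCharacter h₂).le_one x)
      have b₃ := (hM.isCharacter h₂).nonneg x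
      rw [mul_div_right_comm, abs_of_nonneg (mul_nonneg b₁.1 b₂)]
      exact (mul_le_of_le_one_right b₁.1 (by linarith)).trans b₁.2
    have hl1 := hlim _ _ (hM.continuous_mul_div_defect hw hws h₁ h₂) hbd
    have hl2 := ((hexp χ₁ h₁).add (hexp χ₂ h₂)).sub (hexp _ h₁₂)
    have key : ∫ x, (1 - χ₁ x) * (1 - χ₂ x) / defect 𝒳 w x ∂κ =
        exponent μ χ₁ + exponent μ χ₂ - exponent μ (χ₁ * χ₂) := by
      refine tendsto_nhds_unique hl1 (hl2.congr fun n => ?_)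
      have i₁ := hM.integrable h₁ (μ ((n : ℝ≥0) + 1)⁻¹)
      have i₂ := hM.integrable h₂ (μ ((n : ℝ≥0) + 1)⁻¹)
      have i₃ := hM.integrable h₁₂ (μ ((n : ℝ≥0) + 1)⁻¹)
      have e1 : ∀ x, (1 - χ₁ x) * (1 - χ₂ x) / defect 𝒳 w x * defect 𝒳 w x =
          (1 - χ₁ x) + (1 - χ₂ x) - (1 - (χ₁ * χ₂) x) := fun x => by
        by_cases hx : x = 0
        · simp [hx, (hM.isCharacter h₁).map_zero, (hM.isCharacter h₂).map_zero]
        · rw [div_mul_cancel₀ _ (hM.defect_pos hw hws hx).ne', Pi.mul_apply]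
          ring
      simp only [e1]
      have j₁ := (integrable_const (1 : ℝ)).sub i₁
      have j₂ := (integrable_const (1 : ℝ)).sub i₂
      have j₃ := (integrable_const (1 : ℝ)).sub i₃
      have e2 := integral_sub (j₁.add j₂) j₃
      have e3 := integral_add j₁ j₂
      simp only [Pi.add_apply, Pi.sub_apply] at e2 e3
      rw [e2, e3]
      ring
    have e2 := integral_sub ((hGi χ₁ h₁).add (hGi χ₂ h₂)) (hGi _ h₁₂)
    have e3 := integral_add (hGi χ₁ h₁) (hGi χ₂ h₂)
    simp only [Pi.add_apply] at e2 e3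
    have e4 : ∫ x, (1 - χ₁ x) * (1 - χ₂ x) / defect 𝒳 w x ∂κ = G χ₁ + G χ₂ - G (χ₁ * χ₂) := by
      simp only [G]
      rw [← e3, ← e2]
      refine integral_congr_ae (ae_of_all _ fun x => ?_)
      simp only [Pi.mul_apply]
      ring
    change exponent μ (χ₁ * χ₂) - G (χ₁ * χ₂) = exponent μ χ₁ - G χ₁ + (exponent μ χ₂ - G χ₂)
    linarith
  · have h1 : Integrable (fun x => 1 - χ x) κ' := by
      refine (integrable_withDensity_iff_integrable_smul hρ).2 ?_
      exact (hGi χ hχ).congr (ae_of_all _ fun x => (hρsmul (fun x => 1 - χ x) x).symm)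
    have h2 : Integrable (fun x => 1 - χ x) ((κ'.comap e).map e) := by
      rw [hmap]
      exact h1.restrict
    exact he.integrable_map_iff.1 h2
  · rw [hνint χ hχ]
    exact (sub_add_cancel _ _).symm
  · -- Extended by `l` at `0`, the quotient becomes a bounded continuous function.
    have hfc : Continuous (Function.update (fun x => (1 - χ x) / defect 𝒳 w x) 0 l) := by
      refine continuous_iff_continuousAt.2 fun x => ?_
      by_cases hx : x = 0
      · subst hx
        exact continuousAt_update_same.2 hl
      · refine (continuousAt_update_of_ne hx).2 ?_
        exact (continuous_const.sub (hM.continuous hχ)).continuousAt.div hdc.continuousAt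
          (hM.defect_pos hw hws hx).ne'
    have hfb : ∀ x, |Function.update (fun x => (1 - χ x) / defect 𝒳 w x) 0 l x| ≤
        max |l| (1 / w ⟨χ, hχ⟩) := fun x => by
      by_cases hx : x = 0
      · subst hx
        simp
      · have hb := hM.one_sub_div_defect_mem_Icc hw hws x hχ
        rw [Function.update_of_ne hx, abs_of_nonneg hb.1]
        exact hb.2.trans (le_max_right _ _)
    have key : ∫ x, Function.update (fun x => (1 - χ x) / defect 𝒳 w x) 0 l x ∂κ =
        exponent μ χ := by
      refine tendsto_nhds_unique (hlim _ _ hfc hfb) ((hexp χ hχ).congr fun n => ?_)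
      congr 1
      refine integral_congr_ae (ae_of_all _ fun x => ?_)
      by_cases hx : x = 0
      · simp [hx, (hM.isCharacter hχ).map_zero, hM.defect_zero]
      · simp only [Function.update_of_ne hx]
        rw [div_mul_cancel₀ _ (hM.defect_pos hw hws hx).ne']
    have hsplit : ∀ x, Function.update (fun x => (1 - χ x) / defect 𝒳 w x) 0 l x =
        (1 - χ x) / defect 𝒳 w x + ({0} : Set M).indicator (fun _ => l) x := fun x => by
      by_cases hx : x = 0
      · simp [hx, hM.defect_zero]
      · simp [hx]
    simp only [hsplit] at key
    rw [integral_add (hGi χ hχ) ((integrable_const l).indicator (measurableSet_singleton _)),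
      integral_indicator_const _ (measurableSet_singleton _), smul_eq_mul] at key
    change exponent μ χ - G χ = _
    rw [← key]
    exact add_sub_cancel_left _ _

end IsFellerTopologicalMonoid

end Levy

section Drift

/-! ### Comparison of weights -/

variable {M : Type*} [AddCommMonoid M] [TopologicalSpace M] [MeasurableSpace M] [BorelSpace M]
  {𝒳 : Set (M → ℝ)} {w v : 𝒳 → ℝ} {μ : ℝ≥0 → Measure M} [∀ t, IsProbabilityMeasure (μ t)]

/-- If a single `1 - χ₀` dominates `∑ w(χ) (1 - χ)` near the neutral element, then the latter has a
finite rate. Away from the neutral element it is dominated by `∑ v(χ) (1 - χ)`, for any weight `v`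
that gives a finite rate. -/
theorem IsFellerTopologicalMonoid.summable_of_tendsto_pos (hM : IsFellerTopologicalMonoid M 𝒳)
    (h : IsConvolutionSemigroup μ) (hw : ∀ χ, 0 < w χ) (hws : Summable w)
    (hv : ∀ χ, 0 < v χ) (hvs : Summable v)
    (hve : Summable fun χ : 𝒳 => v χ * exponent μ χ) {χ₀ : M → ℝ} (hχ₀ : χ₀ ∈ 𝒳) {l : ℝ}
    (hl0 : 0 < l) (hl : Tendsto (fun x => (1 - χ₀ x) / defect 𝒳 w x) (𝓝[≠] 0) (𝓝 l)) :
    Summable fun χ : 𝒳 => w χ * exponent μ χ := by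
  have hU := eventually_nhdsWithin_iff.1 (hl.eventually (lt_mem_nhds (half_lt_self hl0)))
  obtain ⟨δ, hδ, hδU⟩ := hM.exists_pos_le_defect hv hvs hU
  have hW : 0 ≤ ∑' χ, w χ := tsum_nonneg fun χ => (hw χ).le
  have hc := hM.isCharacter hχ₀
  have hdom : ∀ x, defect 𝒳 w x ≤
      2 / l * (1 - χ₀ x) + (∑' χ, w χ) / δ * defect 𝒳 v x := fun x => by
    have h1 : 0 ≤ 2 / l * (1 - χ₀ x) :=
      mul_nonneg (by positivity) (sub_nonneg.2 (hc.le_one x))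
    have h2 : 0 ≤ (∑' χ, w χ) / δ * defect 𝒳 v x :=
      mul_nonneg (by positivity) (hM.defect_nonneg hv x)
    by_cases hx0 : x = 0
    · have h3 : defect 𝒳 w x = 0 := by rw [hx0, hM.defect_zero]
      linarith
    by_cases hxU : x ≠ 0 → l / 2 < (1 - χ₀ x) / defect 𝒳 w x
    · have h3 := hxU hx0
      rw [lt_div_iff₀ (hM.defect_pos hw hws hx0)] at h3
      have h4 := mul_le_mul_of_nonneg_left h3.le (by positivity : 0 ≤ 2 / l)
      rw [← mul_assoc, div_mul_div_cancel₀ hl0.ne', div_self two_ne_zero, one_mul] at h4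
      linarith
    · have h3 := mul_le_mul_of_nonneg_left (hδU x hxU) (div_nonneg hW hδ.le)
      rw [div_mul_cancel₀ _ hδ.ne'] at h3
      linarith [hM.defect_le hw hws x]
  refine summable_of_sum_le (c := 2 / l * exponent μ χ₀ +
    (∑' χ, w χ) / δ * ∑' χ : 𝒳, v χ * exponent μ χ)
    (fun χ => mul_nonneg (hw χ).le (hM.exponent_nonneg χ.2)) fun F => ?_
  have hlim := tendsto_finsetSum F fun (χ : 𝒳) _ =>
    (hM.tendsto_mul_one_sub_laplace h χ.2).const_mul (w χ)
  refine le_of_tendsto' hlim fun n => ?_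
  set m := μ ((n : ℝ≥0) + 1)⁻¹
  have hi : ∀ {χ}, χ ∈ 𝒳 → Integrable (fun x => 1 - χ x) m := fun hχ =>
    (integrable_const (1 : ℝ)).sub (hM.integrable hχ m)
  have e1 : ∑ χ ∈ F, w χ * (((n : ℝ) + 1) * (1 - laplace m χ)) =
      ((n : ℝ) + 1) * ∫ x, ∑ χ ∈ F, w χ * (1 - (χ : M → ℝ) x) ∂m := by
    rw [integral_finsetSum _ fun χ _ => (hi χ.2).const_mul _, Finset.mul_sum]
    refine Finset.sum_congr rfl fun χ _ => ?_
    rw [integral_const_mul, hM.integral_one_sub χ.2]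
    ring
  have e2 : ∫ x, ∑ χ ∈ F, w χ * (1 - (χ : M → ℝ) x) ∂m ≤
      2 / l * (1 - laplace m χ₀) + (∑' χ, w χ) / δ * ∫ x, defect 𝒳 v x ∂m := by
    rw [← hM.integral_one_sub hχ₀, ← integral_const_mul, ← integral_const_mul,
      ← integral_add ((hi hχ₀).const_mul _) ((hM.integrable_defect hv hvs m).const_mul _)]
    refine integral_mono (integrable_finsetSum _ fun χ _ => (hi χ.2).const_mul _)
      (((hi hχ₀).const_mul _).add ((hM.integrable_defect hv hvs m).const_mul _)) fun x => ?_
    exact ((hM.summable_defect hw hws x).sum_le_tsum F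
      fun χ _ => (hM.defect_term_mem_Icc hw x χ).1).trans (hdom x)
  have e3 := mul_le_mul_of_nonneg_left (hM.mul_one_sub_laplace_le h hχ₀ n)
    (by positivity : 0 ≤ 2 / l)
  have e4 := mul_le_mul_of_nonneg_left (hM.mul_integral_defect_le h hv hvs hve n)
    (div_nonneg hW hδ.le)
  rw [e1]
  refine (mul_le_mul_of_nonneg_left e2 (by positivity)).trans ?_
  calc _ = 2 / l * (((n : ℝ) + 1) * (1 - laplace m χ₀)) +
        (∑' χ, w χ) / δ * (((n : ℝ) + 1) * ∫ x, defect 𝒳 v x ∂m) := by ring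
    _ ≤ _ := add_le_add e3 e4

end Drift

end FellerMonoid

theorem mainTheorem1 {M : Type*} [AddCommMonoid M] [TopologicalSpace M] [MeasurableSpace M]
    [BorelSpace M] (𝒳 : Set (M → ℝ)) (hM : FellerMonoid.IsFellerTopologicalMonoid M 𝒳)
    (μ : ℝ≥0 → Measure M) (hμ : ∀ t, IsProbabilityMeasure (μ t)) :
    (FellerMonoid.DeterminesFellerSemigroup μ ↔ FellerMonoid.IsConvolutionSemigroup μ) ∧
    ∀ (ord : 𝒳 → ℕ) (α : (M → ℝ) → ℝ),
      FellerMonoid.IsOrdering 𝒳 ord → FellerMonoid.ConditionI 𝒳 ord α →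
      (FellerMonoid.DeterminesFellerSemigroup μ ∨ FellerMonoid.IsConvolutionSemigroup μ) →
      ∃ (a : (M → ℝ) → ℝ) (ν : Measure {x : M // x ≠ 0}),
        (∀ χ ∈ 𝒳, 0 ≤ a χ) ∧
        (∀ χ₁ ∈ 𝒳, ∀ χ₂ ∈ 𝒳, a (χ₁ * χ₂) = a χ₁ + a χ₂) ∧
        (∀ χ ∈ 𝒳, Integrable (fun x : {x : M // x ≠ 0} => 1 - χ x) ν) ∧
        (∀ χ ∈ 𝒳, ∀ t : ℝ≥0, FellerMonoid.laplace (μ t) χ =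
          Real.exp (-((t : ℝ) * (a χ + ∫ x : {x : M // x ≠ 0}, (1 - χ x) ∂ν)))) ∧
        (((∃ χ ∈ 𝒳, α χ ≠ 0) ∨ (∀ x : M, x + x = x) ∨
            Summable (fun χ : 𝒳 =>
              -Real.log (FellerMonoid.laplace (μ 1) (χ : M → ℝ)) / 2 ^ (ord χ + 1))) →
          ∃ c : ℝ, 0 ≤ c ∧ ∀ χ ∈ 𝒳, a χ = c * α χ) := by
  refine ⟨hM.determinesFellerSemigroup_iff μ, fun ord α hord hα hab => ?_⟩
  have h : FellerMonoid.IsConvolutionSemigroup μ :=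
    hab.elim (hM.determinesFellerSemigroup_iff μ).1 id
  set w : 𝒳 → ℝ := fun χ => 1 / 2 ^ (ord χ + 1) with hwdef
  have hw : ∀ χ, 0 < w χ := fun χ => by positivity
  have hws : Summable w := by
    have h1 := ((summable_nat_add_iff 1).2 summable_geometric_two).comp_injective hord.1
    simpa [w, Function.comp_def] using h1
  have hα' : ∀ χ ∈ 𝒳, Tendsto (fun x => (1 - χ x) / FellerMonoid.defect 𝒳 w x) (𝓝[≠] 0)
      (𝓝 (α χ)) := fun χ hχ => by
    rw [hwdef, ← FellerMonoid.phi_eq_defect]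
    exact (hα χ hχ).2
  have hsum : (fun χ : 𝒳 => -Real.log (FellerMonoid.laplace (μ 1) (χ : M → ℝ)) /
      2 ^ (ord χ + 1)) = fun χ : 𝒳 => w χ * FellerMonoid.exponent μ χ := by
    funext χ
    simp only [w, FellerMonoid.exponent]
    ring
  rw [hsum]
  by_cases hwe : Summable fun χ : 𝒳 => w χ * FellerMonoid.exponent μ χ
  · obtain ⟨a, ν, ha0, hadd, hint, hexp, c, hc, hca⟩ := hM.exists_levy_measure h hw hws hwe
    refine ⟨a, ν, ha0, hadd, hint, fun χ hχ t => ?_,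
      fun _ => ⟨c, hc, fun χ hχ => hca χ hχ _ (hα' χ hχ)⟩⟩
    rw [← hexp χ hχ, (hM.laplace_pos_and_eq h hχ t).2]
  -- Dividing the weights `2⁻ⁿ` by `1 + Φ` makes `∑ v(χ) Φ(χ)` finite.
  · let v : 𝒳 → ℝ := fun χ => w χ / (1 + FellerMonoid.exponent μ χ)
    have he : ∀ χ : 𝒳, 0 ≤ FellerMonoid.exponent μ χ := fun χ => hM.exponent_nonneg χ.2
    have hv : ∀ χ, 0 < v χ := fun χ => div_pos (hw χ) (by linarith [he χ])
    have hvs : Summable v := Summable.of_nonneg_of_le (fun χ => (hv χ).le)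
      (fun χ => div_le_self (hw χ).le (by linarith [he χ])) hws
    have hve : Summable fun χ : 𝒳 => v χ * FellerMonoid.exponent μ χ := by
      refine Summable.of_nonneg_of_le (fun χ => mul_nonneg (hv χ).le (he χ)) (fun χ => ?_) hws
      rw [div_mul_eq_mul_div, div_le_iff₀ (by linarith [he χ])]
      exact mul_le_mul_of_nonneg_left (by linarith) (hw χ).le
    obtain ⟨a, ν, ha0, hadd, hint, hexp, -⟩ := hM.exists_levy_measure h hv hvs hve
    refine ⟨a, ν, ha0, hadd, hint, fun χ hχ t => ?_, ?_⟩
    · rw [← hexp χ hχ, (hM.laplace_pos_and_eq h hχ t).2]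
    · rintro (⟨χ₀, hχ₀, hne⟩ | hidem | hs)
      · exact absurd (hM.summable_of_tendsto_pos h hw hws hv hvs hve hχ₀
          (lt_of_le_of_ne (hα χ₀ hχ₀).1 hne.symm) (hα' χ₀ hχ₀)) hwe
      · refine ⟨0, le_rfl, fun χ hχ => ?_⟩
        have h1 : χ * χ = χ := funext fun x => by
          rw [Pi.mul_apply, ← (hM.isCharacter hχ).map_add, hidem]
        have h2 := hadd χ hχ χ hχ
        rw [h1] at h2
        linarith
      · exact absurd hs hwe
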